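/- Let $(M,g)$ be a smooth (Hausdorff, finite-dimensional, without boundary) Riemannian manifold with Levi-Civita connection $\nabla$, and let $X$ be a smooth vector field on $M$ with (maximal, local) flow $\mathrm{Fl}^X$. For $p\in M$ let $\|\nabla X(p)\|_g$ denote the operator norm of the endomorphism $v\mapsto\nabla_v X$ of the normed space $(T_pM,\|\cdot\|_g)$. Let $a<b$, let $c_0:[a,b]\to M$ be a smooth regular curve (that is, $c_0'(\tau)\neq 0$ for all $\tau\in[a,b]$), and let $T>0$ be such that $\mathrm{Fl}^X$ is defined on $[0,T]\times c_0([a,b])$. Put $c(t,\tau):=\mathrm{Fl}^X_t(c_0(\tau))$ for $t\in[0,T]$, $\tau\in[a,b]$, and $$C_T:=\sup\{\|\nabla X(p)\|_g : p\in c([0,T]\times[a,b])\}.$$ Then $C_T<\infty$, and for every $t\in[0,T]$ the curve $\tau\mapsto c(t,\tau)$ is of class $C^1$ on $[a,b]$, so that it has a finite length $l(t)=\int_a^b\|\partial_\tau c(t,\tau)\|_g\,d\tau$, and $$l(t)\le l(0)\,e^{C_T t}.$$ -/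

import Mathlib

open Set Bundle MeasureTheory
open scoped Manifold ContDiff Topology ENNReal

namespace RiemannianGronwall

noncomputable section

variable {E : Type*} [NormedAddCommGroup E] [NormedSpace ℝ E]
  {M : Type*} [TopologicalSpace M] [ChartedSpace E M]

/-- The domain of definition of the (maximal) flow of `X`: all `(t, p)` such that an integral
curve of `X` through `p` at time `0` exists on some open interval containing `0` and `t`. -/
def flowDomain (X : ∀ p : M, TangentSpace 𝓘(ℝ, E) p) : Set (ℝ × M) :=
  {x | ∃ (γ : ℝ → M) (s u : ℝ), (0 : ℝ) ∈ Ioo s u ∧ x.1 ∈ Ioo s u ∧ γ 0 = x.2 ∧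
    IsMIntegralCurveOn γ X (Ioo s u)}

open Classical in
/-- The flow of `X`: on the flow domain, the value at time `t` of an integral curve of `X` starting
at `p` at time `0` (on a Hausdorff manifold and for `X` of class `C¹` this does not depend on the
choice of the curve); outside the flow domain the value is the junk value `p`. -/
def flow (X : ∀ p : M, TangentSpace 𝓘(ℝ, E) p) (t : ℝ) (p : M) : M :=
  if h : (t, p) ∈ flowDomain X then h.choose t else p

lemma mvfderiv_congr {F : Type*} [NormedAddCommGroup F] [NormedSpace ℝ F] {f g : M → F} {p : M}
    (h : f =ᶠ[𝓝 p] g) : mvfderiv 𝓘(ℝ, E) f p = mvfderiv 𝓘(ℝ, E) g p :=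
  h.mfderiv_eq

/-- The transported curve `c(t, τ) = Fl_t(c₀(τ))`. -/
def transport (X : ∀ p : M, TangentSpace 𝓘(ℝ, E) p) (c₀ : ℝ → M) (t τ : ℝ) : M :=
  flow X t (c₀ τ)

variable [IsManifold 𝓘(ℝ, E) ∞ M]

/-- The vector field `X` read in the chart at `p`, as an `E`-valued function of the point `q`
(meaningful for `q` in the domain of that chart). -/
def coordField (X : ∀ q : M, TangentSpace 𝓘(ℝ, E) q) (p q : M) : E :=
  (trivializationAt E (TangentSpace 𝓘(ℝ, E)) p ⟨q, X q⟩).2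

/-- The derivative at `p` of the components of `X` in the chart at `p`, as an endomorphism of the
tangent space: `v ↦ v(Xⁱ) ∂ᵢ`. -/
def flatDeriv (X : ∀ q : M, TangentSpace 𝓘(ℝ, E) q) (p : M) :
    TangentSpace 𝓘(ℝ, E) p →L[ℝ] TangentSpace 𝓘(ℝ, E) p :=
  (trivializationAt E (TangentSpace 𝓘(ℝ, E)) p).symmL ℝ p ∘L
    mvfderiv 𝓘(ℝ, E) (coordField X p) p

lemma flatDeriv_extend {p : M} (v : TangentSpace 𝓘(ℝ, E) p) :
    flatDeriv (FiberBundle.extend E v) p = 0 := by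
  have e : coordField (FiberBundle.extend E v) p =ᶠ[𝓝 p]
      fun _ ↦ (trivializationAt E (TangentSpace 𝓘(ℝ, E)) p ⟨p, v⟩).2 := by
    filter_upwards [(trivializationAt E (TangentSpace 𝓘(ℝ, E)) p).open_baseSet.mem_nhds
      (FiberBundle.mem_baseSet_trivializationAt' p)] with q hq
    simp only [coordField, FiberBundle.extend]
    rw [(trivializationAt E (TangentSpace 𝓘(ℝ, E)) p).apply_mk_symm hq]
  have h : mvfderiv 𝓘(ℝ, E) (coordField (FiberBundle.extend E v) p) p = 0 := by
    rw [← mvfderiv_const (trivializationAt E (TangentSpace 𝓘(ℝ, E)) p ⟨p, v⟩).2]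
    exact e.mfderiv_eq
  rw [flatDeriv, h, ContinuousLinearMap.comp_zero]

lemma mpullback_extend {p : M} (v : TangentSpace 𝓘(ℝ, E) p) {y : E}
    (hy : y ∈ (extChartAt 𝓘(ℝ, E) p).target) :
    VectorField.mpullbackWithin 𝓘(ℝ, E) 𝓘(ℝ, E) (extChartAt 𝓘(ℝ, E) p).symm
      (FiberBundle.extend E v) (range 𝓘(ℝ, E)) y =
      (trivializationAt E (TangentSpace 𝓘(ℝ, E)) p ⟨p, v⟩).2 := by
  have hq : (extChartAt 𝓘(ℝ, E) p).symm y ∈ (chartAt E p).source := by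
    simpa using (extChartAt 𝓘(ℝ, E) p).map_target hy
  have h := TangentBundle.symmL_trivializationAt (I := 𝓘(ℝ, E)) hq
  have h2 := Trivialization.symmL_apply (R := ℝ) (trivializationAt E (TangentSpace 𝓘(ℝ, E)) p) hq
    (trivializationAt E (TangentSpace 𝓘(ℝ, E)) p ⟨p, v⟩).2
  rw [h, (extChartAt 𝓘(ℝ, E) p).right_inv hy] at h2
  rw [VectorField.mpullbackWithin_apply]
  change ContinuousLinearMap.inverse _ ((trivializationAt E (TangentSpace 𝓘(ℝ, E)) p).symm _ _) = _
  rw [← h2]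
  exact (isInvertible_mfderivWithin_extChartAt_symm hy).inverse_apply_self _

lemma mlieBracket_extend {p : M} (v w : TangentSpace 𝓘(ℝ, E) p) :
    VectorField.mlieBracket 𝓘(ℝ, E) (FiberBundle.extend E v) (FiberBundle.extend E w) p = 0 := by
  have e (u : TangentSpace 𝓘(ℝ, E) p) : VectorField.mpullbackWithin 𝓘(ℝ, E) 𝓘(ℝ, E)
      (extChartAt 𝓘(ℝ, E) p).symm (FiberBundle.extend E u) (range 𝓘(ℝ, E))
      =ᶠ[𝓝 (extChartAt 𝓘(ℝ, E) p p)]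
      fun _ ↦ (trivializationAt E (TangentSpace 𝓘(ℝ, E)) p ⟨p, u⟩).2 := by
    filter_upwards [extChartAt_target_mem_nhds (I := 𝓘(ℝ, E)) p] with y hy
    exact mpullback_extend u hy
  have h := (e v).lieBracketWithin_vectorField_eq_nhds (𝕜 := ℝ)
    (s := (extChartAt 𝓘(ℝ, E) p).symm ⁻¹' univ ∩ range 𝓘(ℝ, E)) (e w)
  rw [← VectorField.mlieBracketWithin_univ, VectorField.mlieBracketWithin_apply]
  erw [h]
  simp only [VectorField.lieBracketWithin, fderivWithin_fun_const, Pi.zero_apply, sub_zero,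
    _root_.zero_apply]
  exact map_zero _

lemma extend_add {p : M} (v v' : TangentSpace 𝓘(ℝ, E) p) :
    ∀ᶠ q in 𝓝 p, FiberBundle.extend E (v + v') q =
      FiberBundle.extend E v q + FiberBundle.extend E v' q := by
  have h := FiberBundle.mem_baseSet_trivializationAt' (F := E) (E := TangentSpace 𝓘(ℝ, E)) p
  filter_upwards [(trivializationAt E (TangentSpace 𝓘(ℝ, E)) p).open_baseSet.mem_nhds h] with q hq
  have e := ((trivializationAt E (TangentSpace 𝓘(ℝ, E)) p).linear ℝ h).map_add v v'
  have l := ((trivializationAt E (TangentSpace 𝓘(ℝ, E)) p).symmₗ ℝ q).map_add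
  simp only [Trivialization.symmₗ_apply (hb := hq)] at l
  exact (congrArg ((trivializationAt E (TangentSpace 𝓘(ℝ, E)) p).symm q) e).trans (l _ _)

lemma extend_smul {p : M} (c : ℝ) (v : TangentSpace 𝓘(ℝ, E) p) :
    ∀ᶠ q in 𝓝 p, FiberBundle.extend E (c • v) q = c • FiberBundle.extend E v q := by
  have h := FiberBundle.mem_baseSet_trivializationAt' (F := E) (E := TangentSpace 𝓘(ℝ, E)) p
  filter_upwards [(trivializationAt E (TangentSpace 𝓘(ℝ, E)) p).open_baseSet.mem_nhds h] with q hq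
  have e := ((trivializationAt E (TangentSpace 𝓘(ℝ, E)) p).linear ℝ h).map_smul c v
  have l := ((trivializationAt E (TangentSpace 𝓘(ℝ, E)) p).symmₗ ℝ q).map_smul
  simp only [Trivialization.symmₗ_apply (hb := hq)] at l
  exact (congrArg ((trivializationAt E (TangentSpace 𝓘(ℝ, E)) p).symm q) e).trans (l _ _)

lemma flatDeriv_add {X Y : ∀ q : M, TangentSpace 𝓘(ℝ, E) q} {p : M}
    (hX : MDiffAt (T% X) p) (hY : MDiffAt (T% Y) p) :
    flatDeriv (X + Y) p = flatDeriv X p + flatDeriv Y p := by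
  rw [mdifferentiableAt_section] at hX hY
  have e : coordField (X + Y) p =ᶠ[𝓝 p] coordField X p + coordField Y p := by
    filter_upwards [(trivializationAt E (TangentSpace 𝓘(ℝ, E)) p).open_baseSet.mem_nhds
      (FiberBundle.mem_baseSet_trivializationAt' p)] with q hq
    exact ((trivializationAt E (TangentSpace 𝓘(ℝ, E)) p).linear ℝ hq).map_add (X q) (Y q)
  have h : mvfderiv 𝓘(ℝ, E) (coordField (X + Y) p) p =
      mvfderiv 𝓘(ℝ, E) (coordField X p) p + mvfderiv 𝓘(ℝ, E) (coordField Y p) p := by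
    exact (mvfderiv_congr e).trans (mvfderiv_add hX hY)
  rw [flatDeriv, h, ContinuousLinearMap.comp_add]; rfl

lemma flatDeriv_smul {X : ∀ q : M, TangentSpace 𝓘(ℝ, E) q} {f : M → ℝ} {p : M}
    (hX : MDiffAt (T% X) p) (hf : MDiffAt f p) :
    flatDeriv (f • X) p = f p • flatDeriv X p + (mvfderiv 𝓘(ℝ, E) f p).smulRight (X p) := by
  rw [mdifferentiableAt_section] at hX
  have e : coordField (f • X) p =ᶠ[𝓝 p] f • coordField X p := by
    filter_upwards [(trivializationAt E (TangentSpace 𝓘(ℝ, E)) p).open_baseSet.mem_nhds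
      (FiberBundle.mem_baseSet_trivializationAt' p)] with q hq
    exact ((trivializationAt E (TangentSpace 𝓘(ℝ, E)) p).linear ℝ hq).map_smul (f q) (X q)
  have h : mvfderiv 𝓘(ℝ, E) (coordField (f • X) p) p =
      f p • mvfderiv 𝓘(ℝ, E) (coordField X p) p
        + (mvfderiv 𝓘(ℝ, E) f p).smulRight (coordField X p p) := by
    exact (mvfderiv_congr e).trans (mvfderiv_smul hf hX)
  ext1 v
  have hp : p ∈ (trivializationAt E (TangentSpace 𝓘(ℝ, E)) p).baseSet :=
    FiberBundle.mem_baseSet_trivializationAt' p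
  have hs : (trivializationAt E (TangentSpace 𝓘(ℝ, E)) p).symmL ℝ p (coordField X p p) = X p := by
    refine (Trivialization.symmL_apply _ hp _).trans ?_
    exact (trivializationAt E (TangentSpace 𝓘(ℝ, E)) p).symm_apply_apply_mk hp (X p)
  simp only [flatDeriv, h, ContinuousLinearMap.comp_apply, _root_.add_apply, _root_.smul_apply,
    ContinuousLinearMap.smulRight_apply, map_add, map_smul, hs]

variable [RiemannianBundle (fun x : M ↦ TangentSpace 𝓘(ℝ, E) x)]

/-- The derivative of the metric coefficients in the chart at `p`: `∂_u g(v, w)` at `p`, where `v`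
and `w` are extended to vector fields that are constant in the chart at `p`. -/
def dMetric (p : M) (u v w : TangentSpace 𝓘(ℝ, E) p) : ℝ :=
  mvfderiv 𝓘(ℝ, E) (fun q : M ↦ inner ℝ (FiberBundle.extend E v q) (FiberBundle.extend E w q)) p u

lemma dMetric_symm (p : M) (u v w : TangentSpace 𝓘(ℝ, E) p) :
    dMetric p u v w = dMetric p u w v := by
  simp only [dMetric, real_inner_comm]

section smoothMetric

variable [IsContMDiffRiemannianBundle 𝓘(ℝ, E) ∞ E (fun x : M ↦ TangentSpace 𝓘(ℝ, E) x)]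

lemma mdiff_inner_extend {p : M} (v w : TangentSpace 𝓘(ℝ, E) p) :
    MDifferentiableAt 𝓘(ℝ, E) 𝓘(ℝ, ℝ)
      (fun q : M ↦ inner ℝ (FiberBundle.extend E v q) (FiberBundle.extend E w q)) p := by
  have hv := FiberBundle.mdifferentiableAt_extend 𝓘(ℝ, E) E v
  have hw := FiberBundle.mdifferentiableAt_extend 𝓘(ℝ, E) E w
  exact MDifferentiableAt.inner_bundle (E := fun x : M ↦ TangentSpace 𝓘(ℝ, E) x) (b := fun q : M ↦ q) hv hw

lemma dMetric_add (p : M) (u v v' w : TangentSpace 𝓘(ℝ, E) p) :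
    dMetric p u (v + v') w = dMetric p u v w + dMetric p u v' w := by
  have e : (fun q : M ↦ inner ℝ (FiberBundle.extend E (v + v') q) (FiberBundle.extend E w q)) =ᶠ[𝓝 p]
      fun q ↦ inner ℝ (FiberBundle.extend E v q) (FiberBundle.extend E w q)
        + inner ℝ (FiberBundle.extend E v' q) (FiberBundle.extend E w q) := by
    filter_upwards [extend_add v v'] with q hq
    rw [hq, inner_add_left]
  have h := mvfderiv_fun_add (mdiff_inner_extend v w) (mdiff_inner_extend v' w)
  exact (congrArg (fun L ↦ L u) ((mvfderiv_congr e).trans h)).trans rfl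

lemma dMetric_smul (p : M) (c : ℝ) (u v w : TangentSpace 𝓘(ℝ, E) p) :
    dMetric p u (c • v) w = c * dMetric p u v w := by
  have e : (fun q : M ↦ inner ℝ (FiberBundle.extend E (c • v) q) (FiberBundle.extend E w q)) =ᶠ[𝓝 p]
      fun q ↦ c * inner ℝ (FiberBundle.extend E v q) (FiberBundle.extend E w q) := by
    filter_upwards [extend_smul c v] with q hq
    rw [hq, real_inner_smul_left]
  have h := mvfderiv_fun_mul (mdifferentiableAt_const (c := c)) (mdiff_inner_extend v w)
  refine (congrArg (fun L ↦ L u) ((mvfderiv_congr e).trans h)).trans ?_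
  simp [mvfderiv_const, dMetric]

/-- The bilinear form `(v, w) ↦ g(∇_v X, w)` on the tangent space at `p`, by the formula of Koszul
in the chart at `p`: with the Christoffel symbols `Γ` of the metric it is
`g(v(Xⁱ) ∂ᵢ, w) + g(Γ(v, X), w)`,
`2 g(Γ(v, X), w) = ∂_v g(X, w) + ∂_X g(v, w) - ∂_w g(v, X)`. -/
def covForm (X : ∀ q : M, TangentSpace 𝓘(ℝ, E) q) (p : M) :
    TangentSpace 𝓘(ℝ, E) p →ₗ[ℝ] TangentSpace 𝓘(ℝ, E) p →ₗ[ℝ] ℝ :=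
  LinearMap.mk₂ ℝ
    (fun v w ↦ inner ℝ (flatDeriv X p v) w
      + (dMetric p v (X p) w + dMetric p (X p) v w - dMetric p w v (X p)) / 2)
    (fun v v' w ↦ by
      have : dMetric p (v + v') (X p) w = dMetric p v (X p) w + dMetric p v' (X p) w := by
        simp [dMetric]
      simp only [map_add, inner_add_left, dMetric_add, this]; ring)
    (fun c v w ↦ by
      have : dMetric p (c • v) (X p) w = c * dMetric p v (X p) w := by simp [dMetric]
      simp only [map_smul, real_inner_smul_left, dMetric_smul, this, smul_eq_mul]; ring)
    (fun v w w' ↦ by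
      have : dMetric p (w + w') v (X p) = dMetric p w v (X p) + dMetric p w' v (X p) := by
        simp [dMetric]
      simp only [inner_add_right, dMetric_symm p _ _ (w + w'), dMetric_add, this,
        dMetric_symm p _ w, dMetric_symm p _ w']; ring)
    (fun c v w ↦ by
      have : dMetric p (c • w) v (X p) = c * dMetric p w v (X p) := by simp [dMetric]
      simp only [real_inner_smul_right, dMetric_symm p _ _ (c • w), dMetric_smul, this,
        dMetric_symm p _ w, smul_eq_mul]; ring)

variable [FiniteDimensional ℝ E]

instance (p : M) : FiniteDimensional ℝ (TangentSpace 𝓘(ℝ, E) p) :=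
  inferInstanceAs (FiniteDimensional ℝ E)

/-- The covariant differential `v ↦ ∇_v X` at `p`: the vector representing `g(∇_v X, ·)`. -/
def covDeriv (X : ∀ q : M, TangentSpace 𝓘(ℝ, E) q) (p : M) :
    TangentSpace 𝓘(ℝ, E) p →L[ℝ] TangentSpace 𝓘(ℝ, E) p :=
  haveI : CompleteSpace (TangentSpace 𝓘(ℝ, E) p) := FiniteDimensional.complete ℝ _
  LinearMap.toContinuousLinearMap
    { toFun := fun v ↦ (InnerProductSpace.toDual ℝ (TangentSpace 𝓘(ℝ, E) p)).symm
        (LinearMap.toContinuousLinearMap (covForm X p v))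
      map_add' := fun v w ↦ by simp only [map_add]
      map_smul' := fun c v ↦ by simp only [map_smul, RingHom.id_apply] }

lemma inner_covDeriv (X : ∀ q : M, TangentSpace 𝓘(ℝ, E) q) (p : M)
    (v w : TangentSpace 𝓘(ℝ, E) p) :
    inner ℝ (covDeriv X p v) w = inner ℝ (flatDeriv X p v) w
      + (dMetric p v (X p) w + dMetric p (X p) v w - dMetric p w v (X p)) / 2 := by
  have : CompleteSpace (TangentSpace 𝓘(ℝ, E) p) := FiniteDimensional.complete ℝ _
  change inner ℝ ((InnerProductSpace.toDual ℝ (TangentSpace 𝓘(ℝ, E) p)).symm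
        (LinearMap.toContinuousLinearMap (covForm X p v))) w = _
  rw [InnerProductSpace.toDual_symm_apply]
  rfl

/-- The Levi-Civita connection of the Riemannian manifold `M`; in the convention of Mathlib,
`leviCivita X p v` is `∇_v X` at `p`, so `leviCivita X p` is the covariant differential of `X` at
`p`, as an endomorphism of the tangent space. It is torsion free and compatible with the metric,
see the two theorems below. -/
def leviCivita : CovariantDerivative 𝓘(ℝ, E) E (fun x : M ↦ TangentSpace 𝓘(ℝ, E) x) where
  toFun := covDeriv
  isCovariantDerivativeOnUniv := 
    { add := fun {X Y p} hX hY _ ↦ by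
        ext1 v
        refine ext_inner_right ℝ fun w ↦ ?_
        have : dMetric p (X p + Y p) v w = dMetric p (X p) v w + dMetric p (Y p) v w := by
          simp [dMetric]
        simp only [_root_.add_apply, inner_add_left, inner_covDeriv, flatDeriv_add hX hY,
          Pi.add_apply, dMetric_add, dMetric_symm p w v, this]
        ring
      leibniz := fun {X f p} hX hf _ ↦ by
        ext1 v
        refine ext_inner_right ℝ fun w ↦ ?_
        have : dMetric p (f p • X p) v w = f p * dMetric p (X p) v w := by simp [dMetric]
        simp only [_root_.add_apply, inner_add_left, inner_covDeriv, flatDeriv_smul hX hf,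
          Pi.smul_apply', dMetric_smul, dMetric_symm p w v, this, _root_.smul_apply,
          real_inner_smul_left]
        ring }

theorem leviCivita_torsion : (leviCivita (E := E) (M := M)).torsion = 0 := by
  ext p v w
  rw [CovariantDerivative.torsion_apply_eq_extend]
  refine ext_inner_right ℝ fun u ↦ ?_
  simp only [inner_sub_left, mlieBracket_extend, leviCivita, inner_covDeriv, flatDeriv_extend, FiberBundle.extend_apply_self]
  simp [dMetric_symm p u v w]
  ring

theorem leviCivita_metric : CovariantDerivative.IsMetricCompatible (V := fun x : M ↦ TangentSpace 𝓘(ℝ, E) x) (leviCivita (E := E) (M := M)) := by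
  have h : IsContMDiffRiemannianBundle 𝓘(ℝ, E) 1 E (fun x : M ↦ TangentSpace 𝓘(ℝ, E) x) := inferInstance
  ext p v w u
  have hc := CovariantDerivative.derivMetricTensor_apply_eq_extend (F := E) (V := fun x : M ↦ TangentSpace 𝓘(ℝ, E) x) (leviCivita (E := E) (M := M)) u v w
  refine hc.trans ?_
  have h1 := inner_covDeriv (FiberBundle.extend E v) p u w
  have h2 := inner_covDeriv (FiberBundle.extend E w) p u v
  rw [real_inner_comm] at h2
  simp only [flatDeriv_extend, FiberBundle.extend_apply_self, _root_.zero_apply,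
    inner_zero_left] at h1 h2
  have h3 : dMetric p u v w - inner ℝ (covDeriv (FiberBundle.extend E v) p u) w
      - inner ℝ v (covDeriv (FiberBundle.extend E w) p u) = 0 := by
    rw [h1, h2, dMetric_symm p u w v]
    ring
  exact h3
/-- The set of the operator norms `‖∇X(p)‖`, with respect to the Riemannian norm on the tangent
space, where `p` runs through the region swept out by the curve `c₀ : [a, b] → M` under the flow
of `X` during `[0, T]`. -/
def sweptNorms (X : ∀ p : M, TangentSpace 𝓘(ℝ, E) p) (c₀ : ℝ → M) (a b T : ℝ) : Set ℝ :=
  {r | ∃ t ∈ Icc 0 T, ∃ τ ∈ Icc a b, r = ‖leviCivita X (transport X c₀ t τ)‖}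

end smoothMetric

end

end RiemannianGronwall

/-! For a tangent vector v at p put w(t) = dFl_t(v). The heart of the proof is the first variation
formula d/dt ‖w‖² = 2 g(∇_w X, w). At time zero it is computed in the chart at p: time and space
derivatives of the flow commute, so the components of w change by the derivative of the components
of X, while the metric coefficients change by their derivative along X; on the diagonal the other
two metric terms of Koszul's formula cancel (`hasDerivAt_norm_sq_mfderiv_flow_zero`). The group law
of the flow moves the formula to every time. By Cauchy–Schwarz the derivative is at most 2 C_T ‖w‖²
in absolute value, and Gronwall gives ‖w(t)‖ ≤ ‖v‖ exp(C_T t) (`norm_mfderiv_flow_le`). Since ∂_τ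
c(t, τ) = dFl_t(c₀'(τ)), integrating over τ gives the length estimate.

Two ingredients support this. Joint smoothness of the flow in time and initial point comes from the
implicit function theorem on a Banach space of continuous curves, with time rescaled to [-1, 1]
(`exists_contDiffAt_eq_primitive`); it is then carried from time zero along an integral curve by the
group law (`contMDiffAt_flow`). Finiteness of C_T holds because the swept region is compact and ‖∇X‖
is locally bounded. The connection is defined at each point through that point's own chart, so its
dependence on the point is read off from the chart-free Koszul formula (`two_mul_inner_leviCivita`,
`eventually_norm_leviCivita_le`). -/

namespace ContinuousMap

/-! ### Smoothness of composition operators on continuous functions -/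

section Postcomp

universe u

variable {K : Type*} [TopologicalSpace K] [CompactSpace K]
  {E : Type u} [NormedAddCommGroup E] [NormedSpace ℝ E]
  {G : Type u} [NormedAddCommGroup G] [NormedSpace ℝ G]

noncomputable instance instNormedAddCommGroupCLM : NormedAddCommGroup C(K, E →L[ℝ] G) :=
  ContinuousMap.instNormedAddCommGroup

/-- Pointwise application of a continuous family of operators to a continuous function. -/
noncomputable def pointwiseApply : C(K, E →L[ℝ] G) →L[ℝ] C(K, E) →L[ℝ] C(K, G) :=
  LinearMap.mkContinuous₂
    (LinearMap.mk₂ ℝ (fun (A : C(K, E →L[ℝ] G)) (h : C(K, E)) ↦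
        (⟨fun r ↦ A r (h r), by fun_prop⟩ : C(K, G)))
      (fun _ _ _ ↦ by ext; simp) (fun _ _ _ ↦ by ext; simp)
      (fun _ _ _ ↦ by ext; simp) (fun _ _ _ ↦ by ext; simp)) 1
    (fun A h ↦ by
      rw [one_mul, ContinuousMap.norm_le _ (by positivity)]
      intro r
      exact ((A r).le_opNorm _).trans (mul_le_mul (A.norm_coe_le_norm r) (h.norm_coe_le_norm r)
        (norm_nonneg _) (norm_nonneg _)))

@[simp] lemma pointwiseApply_apply (A : C(K, E →L[ℝ] G)) (h : C(K, E)) (r : K) :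
    pointwiseApply A h r = A r (h r) := rfl

/-- The composition operator `γ ↦ f ∘ γ` is differentiable if `f` is `C¹`. -/
lemma hasFDerivAt_comp {f : C(E, G)} {f' : C(E, E →L[ℝ] G)}
    (hf : ∀ x, HasFDerivAt f (f' x) x) (γ : C(K, E)) :
    HasFDerivAt (fun η : C(K, E) ↦ f.comp η) (pointwiseApply (f'.comp γ)) γ := by
  rw [hasFDerivAt_iff_isLittleO, Asymptotics.isLittleO_iff]
  intro ε hε
  have hc : IsCompact (range γ) := isCompact_range γ.continuous
  -- Compactness of the range of `γ` gives one `δ` that serves all parameters `r`; the mean value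
  -- inequality on the ball around `γ r` then yields a bound uniform in `r`.
  have hu := hc.uniformContinuousAt_of_continuousAt f'
    (fun x _ ↦ f'.continuous.continuousAt) (Metric.dist_mem_uniformity hε)
  obtain ⟨δ, hδ, h⟩ := Metric.mem_uniformity_dist.1 hu
  filter_upwards [Metric.ball_mem_nhds γ hδ] with η hη
  rw [ContinuousMap.norm_le _ (by positivity)]
  intro r
  have hr : dist (η r) (γ r) < δ := (ContinuousMap.dist_apply_le_dist r).trans_lt hη
  have key := (convex_ball (γ r) δ).norm_image_sub_le_of_norm_hasFDerivWithin_le' (𝕜 := ℝ)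
    (f := f) (f' := f') (φ := f' (γ r)) (C := ε) (fun y _ ↦ (hf y).hasFDerivWithinAt)
    (fun y hy ↦ by
      have := h (a := γ r) (b := y) (by rw [dist_comm]; exact hy) (mem_range_self r)
      rw [← dist_eq_norm, dist_comm]; exact le_of_lt this)
    (Metric.mem_ball_self hδ) hr
  have h2 : ‖η r - γ r‖ ≤ ‖η - γ‖ := (η - γ).norm_coe_le_norm r
  exact key.trans (by gcongr)

/-- The composition operator `γ ↦ f ∘ γ` on spaces of continuous functions is as smooth as `f`. -/
lemma contDiff_comp (n : ℕ) : ∀ {G : Type u} [NormedAddCommGroup G] [NormedSpace ℝ G]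
    {f : C(E, G)} (_ : ContDiff ℝ n f), ContDiff ℝ n (fun η : C(K, E) ↦ f.comp η) := by
  -- The target `G` varies in the induction, because the derivative takes values in `E →L[ℝ] G`;
  -- this is why both spaces share a universe.
  induction n with
  | zero =>
    intro G _ _ f _
    rw [Nat.cast_zero, contDiff_zero]
    exact ContinuousMap.continuous_postcomp _
  | succ n ih =>
    intro G _ _ f hf
    rw [Nat.cast_succ, contDiff_succ_iff_hasFDerivAt] at hf ⊢
    obtain ⟨f', hf', h⟩ := hf
    have h1 : ContDiff ℝ n (fun A : C(K, E →L[ℝ] G) ↦ pointwiseApply A) :=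
      ContinuousLinearMap.contDiff _
    exact ⟨fun γ ↦ pointwiseApply ((⟨f', hf'.continuous⟩ : C(E, E →L[ℝ] G)).comp γ),
      h1.comp (ih (f := ⟨f', hf'.continuous⟩) hf'),
      fun γ ↦ hasFDerivAt_comp (f' := ⟨f', hf'.continuous⟩) h γ⟩

end Postcomp

/-! ### The integration operator on curves over [-1, 1] -/

section Primitive

variable {E : Type*} [NormedAddCommGroup E] [NormedSpace ℝ E]

/-- The primitive vanishing at `0` of a continuous function on `[-1, 1]`. -/
noncomputable def primitive : C(Icc (-1 : ℝ) 1, E) →L[ℝ] C(Icc (-1 : ℝ) 1, E) :=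
  LinearMap.mkContinuous
    { toFun := fun γ ↦ ⟨fun r ↦ ∫ u in (0 : ℝ)..r, IccExtend (by norm_num) γ u,
        (intervalIntegral.continuous_primitive
          (fun a b ↦ (γ.continuous.Icc_extend').intervalIntegrable a b) 0).comp
            continuous_subtype_val⟩
      map_add' := fun γ η ↦ by
        ext r
        exact intervalIntegral.integral_add ((γ.continuous.Icc_extend').intervalIntegrable _ _)
          ((η.continuous.Icc_extend').intervalIntegrable _ _)
      map_smul' := fun c γ ↦ by
        ext r
        exact intervalIntegral.integral_smul c _ } 1
    (fun γ ↦ by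
      rw [one_mul, ContinuousMap.norm_le _ (norm_nonneg _)]
      intro r
      refine (intervalIntegral.norm_integral_le_of_norm_le_const (C := ‖γ‖)
        fun u _ ↦ γ.norm_coe_le_norm _).trans ?_
      have : |(r : ℝ) - 0| ≤ 1 := by rw [sub_zero]; exact abs_le.2 r.2
      nlinarith [norm_nonneg γ])

lemma primitive_apply (γ : C(Icc (-1 : ℝ) 1, E)) (r : Icc (-1 : ℝ) 1) :
    primitive γ r = ∫ u in (0 : ℝ)..r, IccExtend (by norm_num) γ u := rfl

end Primitive

end ContinuousMap

/-! ### Smooth local flows in a vector space, by the implicit function theorem -/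

section LocalFlow

variable {E : Type*} [NormedAddCommGroup E] [NormedSpace ℝ E]

/-- A solution on `[-1, 1]` of the integral equation of the rescaled field `s • F` is, up to
rescaling, an integral curve of `F` on `(-|s|, |s|)`. -/
lemma hasDerivAt_of_eq_primitive [CompleteSpace E] {F : C(E, E)} {γ : C(Icc (-1 : ℝ) 1, E)}
    {s : ℝ} {x : E}
    (h : γ = ContinuousMap.const _ x + s • ContinuousMap.primitive (F.comp γ)) {t : ℝ}
    (ht : t ∈ Ioo (-|s|) |s|) :
    HasDerivAt (fun t ↦ IccExtend (by norm_num : (-1 : ℝ) ≤ 1) γ (t / s))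
      (F (IccExtend (by norm_num : (-1 : ℝ) ≤ 1) γ (t / s))) t := by
  have hs : s ≠ 0 := by rintro rfl; simp at ht
  have mem {t : ℝ} (ht : t ∈ Ioo (-|s|) |s|) : t / s ∈ Icc (-1 : ℝ) 1 := by
    rw [mem_Ioo, ← abs_lt] at ht
    rw [mem_Icc, ← abs_le, abs_div, div_le_one (abs_pos.2 hs)]
    exact ht.le
  have e : (fun t ↦ IccExtend (by norm_num : (-1 : ℝ) ≤ 1) γ (t / s)) =ᶠ[𝓝 t]
      fun t ↦ x + s • ∫ u in (0 : ℝ)..(t / s),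
        IccExtend (by norm_num : (-1 : ℝ) ≤ 1) (F.comp γ) u := by
    filter_upwards [Ioo_mem_nhds ht.1 ht.2] with t ht
    rw [IccExtend_of_mem _ _ (mem ht)]
    conv_lhs => rw [h]
    simp [ContinuousMap.primitive_apply]
  refine HasDerivAt.congr_of_eventuallyEq ?_ e
  have hc : Continuous (IccExtend (by norm_num : (-1 : ℝ) ≤ 1) (F.comp γ)) :=
    (F.comp γ).continuous.Icc_extend'
  have h1 := (intervalIntegral.integral_hasDerivAt_right (hc.intervalIntegrable 0 (t / s))
    (hc.stronglyMeasurableAtFilter _ _) hc.continuousAt).scomp t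
      ((hasDerivAt_id t).div_const s)
  have h2 := (h1.const_smul s).const_add x
  refine h2.congr_deriv ?_
  rw [smul_smul, mul_one_div_cancel hs, one_smul]
  rfl

lemma IccExtend_zero_of_eq_primitive {F : C(E, E)} {γ : C(Icc (-1 : ℝ) 1, E)}
    {s : ℝ} {x : E}
    (h : γ = ContinuousMap.const _ x + s • ContinuousMap.primitive (F.comp γ)) :
    IccExtend (by norm_num : (-1 : ℝ) ≤ 1) γ 0 = x := by
  rw [IccExtend_of_mem _ _ (by norm_num : (0 : ℝ) ∈ Icc (-1 : ℝ) 1), h]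
  simp [ContinuousMap.primitive_apply]

/-- The constant functions, as a continuous linear map. -/
noncomputable def ContinuousMap.constCLM (K : Type*) [TopologicalSpace K] [CompactSpace K]
    (E : Type*) [NormedAddCommGroup E] [NormedSpace ℝ E] : E →L[ℝ] C(K, E) :=
  LinearMap.mkContinuous
    { toFun := fun x ↦ ContinuousMap.const K x
      map_add' := fun _ _ ↦ rfl
      map_smul' := fun _ _ ↦ rfl } 1
    (fun x ↦ by
      rw [one_mul, ContinuousMap.norm_le _ (norm_nonneg _)]
      exact fun _ ↦ le_rfl)

/-- The integral equation of the rescaled flow has solutions near `0` which are as smooth as the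
vector field. -/
lemma exists_contDiffAt_eq_primitive [CompleteSpace E] {n : ℕ} (hn : n ≠ 0) {F : C(E, E)}
    (hF : ContDiff ℝ n F) (x₀ : E) :
    ∃ g : ℝ × E → C(Icc (-1 : ℝ) 1, E), ContDiffAt ℝ n g (0, x₀) ∧
      g (0, x₀) = ContinuousMap.const _ x₀ ∧ ∀ᶠ z in 𝓝 ((0 : ℝ), x₀),
        g z = ContinuousMap.const _ z.2 + z.1 • ContinuousMap.primitive (F.comp (g z)) := by
  -- Zeros of `Ψ` are the solutions of the rescaled integral equation. Rescaling makes the time `s`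
  -- a parameter, so all curves live on the same interval [-1, 1].
  let Ψ : (ℝ × E) × C(Icc (-1 : ℝ) 1, E) → C(Icc (-1 : ℝ) 1, E) := fun w ↦
    w.2 - ContinuousMap.constCLM _ E w.1.2 - w.1.1 • ContinuousMap.primitive (F.comp w.2)
  let u : (ℝ × E) × C(Icc (-1 : ℝ) 1, E) := ((0, x₀), ContinuousMap.const _ x₀)
  have hu : Ψ u = 0 := by
    simp only [Ψ, u, zero_smul, sub_zero]
    exact sub_self _
  have hΨ : ContDiff ℝ n Ψ := by
    have h1 : ContDiff ℝ n (fun w : (ℝ × E) × C(Icc (-1 : ℝ) 1, E) ↦ F.comp w.2) :=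
      (ContinuousMap.contDiff_comp n hF).comp contDiff_snd
    have h2 : ContDiff ℝ n (fun w : (ℝ × E) × C(Icc (-1 : ℝ) 1, E) ↦
        ContinuousMap.primitive (F.comp w.2)) :=
      (ContinuousLinearMap.contDiff (ContinuousMap.primitive (E := E))).comp h1
    have h3 : ContDiff ℝ n (fun w : (ℝ × E) × C(Icc (-1 : ℝ) 1, E) ↦
        ContinuousMap.constCLM (Icc (-1 : ℝ) 1) E w.1.2) :=
      (ContinuousLinearMap.contDiff (ContinuousMap.constCLM (Icc (-1 : ℝ) 1) E)).comp
        (contDiff_snd.comp contDiff_fst)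
    exact (contDiff_snd.sub h3).sub ((contDiff_fst.comp contDiff_fst).smul h2)
  have hn' : (n : WithTop ℕ∞) ≠ 0 := by exact_mod_cast hn
  -- At `s = 0` the integral term vanishes, so `Ψ` is a translation in the curve variable and its
  -- partial derivative there is the identity.
  have hinv : fderiv ℝ Ψ u ∘L .inr ℝ (ℝ × E) C(Icc (-1 : ℝ) 1, E) =
      ContinuousLinearMap.id ℝ _ := by
    have h1 : HasFDerivAt (fun γ ↦ Ψ (u.1, γ))
        (fderiv ℝ Ψ u ∘L .inr ℝ (ℝ × E) C(Icc (-1 : ℝ) 1, E)) u.2 :=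
      ((hΨ.differentiable hn') u).hasFDerivAt.comp u.2 (hasFDerivAt_prodMk_right u.1 u.2)
    have h2 : HasFDerivAt (fun γ ↦ Ψ (u.1, γ)) (ContinuousLinearMap.id ℝ _) u.2 := by
      have : (fun γ ↦ Ψ (u.1, γ)) = fun γ ↦ γ - ContinuousMap.constCLM _ E x₀ := by
        funext γ; simp [Ψ, u]
      rw [this]
      exact (hasFDerivAt_id _).sub_const _
    exact h1.unique h2
  have hi : (fderiv ℝ Ψ u ∘L .inr ℝ (ℝ × E) C(Icc (-1 : ℝ) 1, E)).IsInvertible := by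
    rw [hinv]; exact ⟨ContinuousLinearEquiv.refl ℝ _, rfl⟩
  have cdf : ContDiffAt ℝ n Ψ u := hΨ.contDiffAt
  refine ⟨cdf.implicitFunction hn' hi, cdf.contDiffAt_implicitFunction hn' hi,
    cdf.implicitFunction_apply_self hn' hi, ?_⟩
  filter_upwards [cdf.eventually_apply_implicitFunction hn' hi] with z hz
  rw [hu] at hz
  rw [← sub_eq_zero, ← sub_sub]
  exact hz

/-- A vector field can be extended from a neighbourhood of a point to the whole space. -/
lemma ContDiffAt.exists_contDiff_eventuallyEq [FiniteDimensional ℝ E] {G : Type*}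
    [NormedAddCommGroup G] [NormedSpace ℝ G] {n : ℕ} {F : E → G} {x₀ : E}
    (hF : ContDiffAt ℝ n F x₀) : ∃ F' : E → G, ContDiff ℝ n F' ∧ F' =ᶠ[𝓝 x₀] F := by
  obtain ⟨u, hu, hFu⟩ := hF.contDiffOn (m := n) le_rfl (by simp)
  obtain ⟨ρ, hρ, hρu⟩ := Metric.nhds_basis_closedBall.mem_iff.1 (interior_mem_nhds.2 hu)
  -- The bump equals 1 near `x₀`, and its closed support lies in the interior of the set where `F`
  -- is smooth; off that support the product vanishes locally.
  let f : ContDiffBump x₀ := ⟨ρ / 2, ρ, by positivity, by linarith⟩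
  refine ⟨fun x ↦ f x • F x, ?_, ?_⟩
  · rw [contDiff_iff_contDiffAt]
    intro x
    by_cases hx : x ∈ tsupport f
    · rw [f.tsupport_eq] at hx
      have := hρu hx
      exact f.contDiff.contDiffAt.smul (hFu.contDiffAt (mem_interior_iff_mem_nhds.1 this))
    · have : (fun x ↦ f x • F x) =ᶠ[𝓝 x] fun _ ↦ 0 := by
        filter_upwards [notMem_tsupport_iff_eventuallyEq.1 hx] with y hy
        simp [hy]
      exact contDiffAt_const.congr_of_eventuallyEq this
  · filter_upwards [f.eventuallyEq_one] with x hx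
    simp [hx]

/-- **Smooth dependence on initial conditions**, local form: a vector field of class `C^n` near
`x₀` has a local flow of class `C^n` near `(0, x₀)`. -/
theorem ContDiffAt.exists_contDiffAt_localFlow [FiniteDimensional ℝ E] {n : ℕ} (hn : n ≠ 0)
    {F : E → E} {x₀ : E} (hF : ContDiffAt ℝ n F x₀) {V : Set E} (hV : V ∈ 𝓝 x₀) :
    ∃ φ : ℝ × E → E, ContDiffAt ℝ n φ (0, x₀) ∧ ∀ᶠ z in 𝓝 ((0 : ℝ), x₀),
      ∃ β : ℝ → E, β 0 = z.2 ∧ β z.1 = φ z ∧ ∃ r > |z.1|, ∀ t ∈ Ioo (-r) r,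
        β t ∈ V ∧ HasDerivAt β (F (β t)) t := by
  have : CompleteSpace E := FiniteDimensional.complete ℝ E
  obtain ⟨F', hF', hFF'⟩ := hF.exists_contDiff_eventuallyEq
  obtain ⟨g, hg, hg₀, hgz⟩ := exists_contDiffAt_eq_primitive hn (F := ⟨F', hF'.continuous⟩) hF' x₀
  obtain ⟨ρ, hρ, hρV⟩ := Metric.mem_nhds_iff.1 (Filter.inter_mem hV hFF')
  -- Closeness in the sup norm to the constant curve keeps the whole solution in `V` and in the
  -- region where the extension `F'` agrees with `F`.
  have hball := hg.continuousAt.preimage_mem_nhds (Metric.ball_mem_nhds _ hρ)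
  obtain ⟨S, hS, U, hU, hSU⟩ := mem_nhds_prod_iff.1 (Filter.inter_mem hgz hball)
  obtain ⟨δ, hδ, hδS⟩ := Metric.mem_nhds_iff.1 hS
  have key {s : ℝ} {x : E} (hs : |s| < δ) (hx : x ∈ U) {t : ℝ} (ht : t ∈ Ioo (-|s|) |s|) :
      IccExtend (by norm_num : (-1 : ℝ) ≤ 1) (g (s, x)) (t / s) ∈ V ∧
      HasDerivAt (fun t ↦ IccExtend (by norm_num : (-1 : ℝ) ≤ 1) (g (s, x)) (t / s))
        (F (IccExtend (by norm_num : (-1 : ℝ) ≤ 1) (g (s, x)) (t / s))) t := by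
    have hz := hSU (mk_mem_prod (hδS (by simpa using hs)) hx)
    have h1 := hasDerivAt_of_eq_primitive hz.1 ht
    have hd : Dist.dist (g (s, x)) (ContinuousMap.const _ x₀) < ρ := hg₀ ▸ hz.2
    have h2 := hρV (Metric.mem_ball.2 ((ContinuousMap.dist_apply_le_dist (f := g (s, x))
      (g := ContinuousMap.const _ x₀) (projIcc (-1 : ℝ) 1 (by norm_num) (t / s))).trans_lt hd))
    exact ⟨h2.1, h1.congr_deriv h2.2⟩
  have hmem : (1 / 2 : ℝ) ∈ Icc (-1 : ℝ) 1 := by norm_num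
  -- Scale `2 s` evaluated at `1 / 2`: the integral curve then lives on an open interval of radius
  -- `|2 s|`, which contains the time `s` in its interior.
  refine ⟨fun z ↦ g (2 * z.1, z.2) ⟨1 / 2, hmem⟩, ?_, ?_⟩
  · have h1 : ContDiffAt ℝ n (fun z : ℝ × E ↦ (2 * z.1, z.2)) (0, x₀) := by fun_prop
    have h2 : ContDiffAt ℝ n (fun z : ℝ × E ↦ g (2 * z.1, z.2)) (0, x₀) :=
      ContDiffAt.comp (0, x₀) (by simpa using hg) h1
    exact (ContinuousMap.evalCLM ℝ (⟨1 / 2, hmem⟩ : Icc (-1 : ℝ) 1)).contDiff.contDiffAt.comp _ h2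
  · filter_upwards [prod_mem_nhds (Metric.ball_mem_nhds (0 : ℝ) (half_pos hδ)) hU]
    rintro ⟨s, x⟩ ⟨hs, hx⟩
    simp only [Metric.mem_ball, dist_zero_right, Real.norm_eq_abs] at hs hx
    -- For `s = 0` the interval of radius `|2 s|` is empty, so the witness curve is taken at the
    -- nonzero scale `δ / 2`.
    rcases eq_or_ne s 0 with rfl | hs0
    · have h2 : |δ / 2| < δ := by rw [abs_of_pos (half_pos hδ)]; linarith
      have hz0 := hSU (mk_mem_prod (hδS (Metric.mem_ball_self hδ)) hx)
      have hz1 := hSU (mk_mem_prod (hδS (by simpa using h2)) hx)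
      have e := IccExtend_zero_of_eq_primitive hz1.1
      refine ⟨fun t ↦ IccExtend (by norm_num : (-1 : ℝ) ≤ 1) (g (δ / 2, x)) (t / (δ / 2)),
        ?_, ?_, |δ / 2|, by simpa using hδ.ne', fun t ht ↦ key h2 hx ht⟩
      · simpa using e
      · have e2 : g (0, x) = ContinuousMap.const _ x := by
          have := hz0.1
          simpa only [mem_ofPred, zero_smul, add_zero] using this
        simp only [zero_div, mul_zero]
        rw [e, e2]; rfl
    · have h2 : |2 * s| < δ := by rw [abs_mul, abs_two]; linarith
      have hz1 := hSU (mk_mem_prod (hδS (mem_ball_zero_iff.2 h2)) hx)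
      have e := IccExtend_zero_of_eq_primitive hz1.1
      refine ⟨fun t ↦ IccExtend (by norm_num : (-1 : ℝ) ≤ 1) (g (2 * s, x)) (t / (2 * s)),
        ?_, ?_, |2 * s|, ?_, fun t ht ↦ key h2 hx ht⟩
      · simpa using e
      · have : s / (2 * s) = 1 / 2 := by field_simp
        simp only [this]
        rw [IccExtend_of_mem _ _ hmem]
      · rw [abs_mul, abs_two]; linarith [abs_pos.2 hs0]

end LocalFlow

namespace RiemannianGronwall

/-! ### The flow on a manifold: uniqueness, group law, smoothness near time zero -/

section FlowSmooth

variable {E : Type*} [NormedAddCommGroup E] [NormedSpace ℝ E]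
  {M : Type*} [TopologicalSpace M] [ChartedSpace E M] [IsManifold 𝓘(ℝ, E) ∞ M]
  {X : ∀ p : M, TangentSpace 𝓘(ℝ, E) p}

/-- Integral curves of `X` compute the flow. -/
lemma flow_eq_of_isMIntegralCurveOn [T2Space M]
    (hX : ContMDiff 𝓘(ℝ, E) 𝓘(ℝ, E).tangent ∞
      (fun p : M ↦ (⟨p, X p⟩ : TangentBundle 𝓘(ℝ, E) M))) {γ : ℝ → M} {a b t : ℝ}
    (h0 : (0 : ℝ) ∈ Ioo a b) (ht : t ∈ Ioo a b) (hγ : IsMIntegralCurveOn γ X (Ioo a b)) :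
    (t, γ 0) ∈ flowDomain X ∧ flow X t (γ 0) = γ t := by
  have hmem : (t, γ 0) ∈ flowDomain X := ⟨γ, a, b, h0, ht, rfl, hγ⟩
  refine ⟨hmem, ?_⟩
  rw [flow, dif_pos hmem]
  obtain ⟨s, u, h0', ht', hη0, hη⟩ := hmem.choose_spec
  -- Uniqueness on the intersection of the two time intervals compares `γ` with the curve chosen in
  -- the definition of the flow.
  refine isMIntegralCurveOn_Ioo_eqOn_of_contMDiff_boundaryless (t₀ := 0)
    (a := max s a) (b := min u b) ⟨max_lt h0'.1 h0.1, lt_min h0'.2 h0.2⟩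
    (hX.of_le (by norm_cast)) (hη.mono ?_) (hγ.mono ?_) hη0
    ⟨max_lt ht'.1 ht.1, lt_min ht'.2 ht.2⟩
  · exact Ioo_subset_Ioo (le_max_left _ _) (min_le_left _ _)
  · exact Ioo_subset_Ioo (le_max_right _ _) (min_le_right _ _)

/-- The flow is defined by a separate choice of curve for every time; uniqueness fits these choices
together into one integral curve. -/
lemma exists_isMIntegralCurveOn_flow [T2Space M]
    (hX : ContMDiff 𝓘(ℝ, E) 𝓘(ℝ, E).tangent ∞
      (fun p : M ↦ (⟨p, X p⟩ : TangentBundle 𝓘(ℝ, E) M))) {t : ℝ} {p : M}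
    (h : (t, p) ∈ flowDomain X) :
    ∃ a b : ℝ, 0 ∈ Ioo a b ∧ t ∈ Ioo a b ∧ (∀ s ∈ Ioo a b, (s, p) ∈ flowDomain X) ∧
      flow X 0 p = p ∧ IsMIntegralCurveOn (fun s ↦ flow X s p) X (Ioo a b) := by
  obtain ⟨γ, a, b, h0, ht, rfl, hγ⟩ := h
  dsimp at h0 ht ⊢
  refine ⟨a, b, h0, ht, fun s hs ↦ (flow_eq_of_isMIntegralCurveOn hX h0 hs hγ).1,
    (flow_eq_of_isMIntegralCurveOn hX h0 h0 hγ).2, fun s hs ↦ ?_⟩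
  have e : EqOn (fun s ↦ flow X s (γ 0)) γ (Ioo a b) := fun s hs ↦
    (flow_eq_of_isMIntegralCurveOn hX h0 hs hγ).2
  have := (hγ s hs).congr_mono e (e hs) subset_rfl
  rwa [← e hs] at this

/-- The flow is a local one-parameter group. -/
lemma flow_add [T2Space M]
    (hX : ContMDiff 𝓘(ℝ, E) 𝓘(ℝ, E).tangent ∞
      (fun p : M ↦ (⟨p, X p⟩ : TangentBundle 𝓘(ℝ, E) M))) {s t : ℝ} {p : M}
    (ht : (t, p) ∈ flowDomain X) (hs : (s, flow X t p) ∈ flowDomain X) :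
    (s + t, p) ∈ flowDomain X ∧ flow X (s + t) p = flow X s (flow X t p) := by
  obtain ⟨a, b, h0, hta, -, hp, hγ⟩ := exists_isMIntegralCurveOn_flow hX ht
  obtain ⟨c, d, h0', hsc, -, hq, hη⟩ := exists_isMIntegralCurveOn_flow hX hs
  -- The curve starting at `flow X t p`, delayed by `t`, meets the curve of `p` at time `t`; the two
  -- are glued into one integral curve reaching `s + t`.
  have hη' := hη.comp_add (-t)
  have e : {r | r + -t ∈ Ioo c d} = Ioo (c + t) (d + t) := by
    ext r
    simp only [mem_Ioo, mem_ofPred]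
    constructor <;> rintro ⟨h1, h2⟩ <;> constructor <;> linarith
  rw [e] at hη'
  have htt : t ∈ Ioo a b ∩ Ioo (c + t) (d + t) := by
    refine ⟨hta, ?_, ?_⟩ <;> linarith [h0'.1, h0'.2]
  have hst : s + t ∈ Ioo (c + t) (d + t) := by constructor <;> linarith [hsc.1, hsc.2]
  have heq : (fun s ↦ flow X s p) t = ((fun s ↦ flow X s (flow X t p)) ∘ (· + -t)) t := by
    simp [hq]
  have hX1 := hX.of_le (n := ∞) (m := 1) (by norm_cast)
  have hpw := isMIntegralCurveOn_piecewise hX1 hγ hη' htt heq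
  have heqOn := eqOn_piecewise_of_isMIntegralCurveOn_Ioo hX1 hγ hη' htt heq
  rw [Ioo_union_Ioo' (by linarith [htt.1.2, htt.2.1]) (by linarith [htt.1.1, htt.2.2])] at hpw
  have k := flow_eq_of_isMIntegralCurveOn hX (t := s + t)
    ⟨(min_le_left _ _).trans_lt h0.1, h0.2.trans_le (le_max_left _ _)⟩
    ⟨(min_le_right _ _).trans_lt hst.1, hst.2.trans_le (le_max_right _ _)⟩ hpw
  rw [heqOn hst, piecewise_eq_of_mem _ _ _ h0, hp] at k
  simpa using k

/-- The components of a smooth vector field in a chart are smooth. -/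
lemma contMDiffAt_coordField
    (hX : ContMDiff 𝓘(ℝ, E) 𝓘(ℝ, E).tangent ∞
      (fun p : M ↦ (⟨p, X p⟩ : TangentBundle 𝓘(ℝ, E) M))) (p : M) :
    ContMDiffAt 𝓘(ℝ, E) 𝓘(ℝ, E) ∞ (coordField X p) p :=
  (contMDiffAt_section p).1 (hX p)

lemma contDiffAt_coordField_comp_symm
    (hX : ContMDiff 𝓘(ℝ, E) 𝓘(ℝ, E).tangent ∞
      (fun p : M ↦ (⟨p, X p⟩ : TangentBundle 𝓘(ℝ, E) M))) (p : M) :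
    ContDiffAt ℝ ∞ (coordField X p ∘ (extChartAt 𝓘(ℝ, E) p).symm) (extChartAt 𝓘(ℝ, E) p p) := by
  rw [← contMDiffAt_iff_contDiffAt]
  have h1 : ContMDiffAt 𝓘(ℝ, E) 𝓘(ℝ, E) ∞ (extChartAt 𝓘(ℝ, E) p).symm
      (extChartAt 𝓘(ℝ, E) p p) :=
    (contMDiffOn_extChartAt_symm p).contMDiffAt (extChartAt_target_mem_nhds p)
  refine ContMDiffAt.comp _ ?_ h1
  rw [extChartAt_to_inv]
  exact contMDiffAt_coordField hX p

/-- Integral curves of the components of `X` in a chart are integral curves of `X`. -/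
lemma isMIntegralCurveOn_symm_comp {p : M} {β : ℝ → E} {s : Set ℝ}
    (h : ∀ t ∈ s, β t ∈ (extChartAt 𝓘(ℝ, E) p).target ∧
      HasDerivAt β (coordField X p ((extChartAt 𝓘(ℝ, E) p).symm (β t))) t) :
    IsMIntegralCurveOn ((extChartAt 𝓘(ℝ, E) p).symm ∘ β) X s := by
  intro t ht
  obtain ⟨h1, h2⟩ := h t ht
  have hq : (extChartAt 𝓘(ℝ, E) p).symm (β t) ∈ (chartAt E p).source := by
    simpa using (extChartAt 𝓘(ℝ, E) p).map_target h1
  have h3 : HasMFDerivAt 𝓘(ℝ, E) 𝓘(ℝ, E) (extChartAt 𝓘(ℝ, E) p).symm (β t)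
      (mfderiv 𝓘(ℝ, E) 𝓘(ℝ, E) (extChartAt 𝓘(ℝ, E) p).symm (β t)) :=
    (((contMDiffOn_extChartAt_symm (n := ∞) p).contMDiffAt
      ((isOpen_extChartAt_target p).mem_nhds h1)).mdifferentiableAt (by simp)).hasMFDerivAt
  have h4 := h3.comp t h2.hasFDerivAt.hasMFDerivAt
  refine HasMFDerivAt.hasMFDerivWithinAt (h4.congr_mfderiv ?_)
  -- The differential of the inverse chart is the inverse trivialization, so it turns the components
  -- of `X` back into `X`.
  have h5 := TangentBundle.symmL_trivializationAt (I := 𝓘(ℝ, E)) hq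
  rw [(extChartAt 𝓘(ℝ, E) p).right_inv h1] at h5
  have h6 : mfderivWithin 𝓘(ℝ, E) 𝓘(ℝ, E) (extChartAt 𝓘(ℝ, E) p).symm (range 𝓘(ℝ, E)) (β t) =
      mfderiv 𝓘(ℝ, E) 𝓘(ℝ, E) (extChartAt 𝓘(ℝ, E) p).symm (β t) := by
    rw [modelWithCornersSelf_coe, range_id, mfderivWithin_univ]
  rw [h6] at h5
  have h7 : (trivializationAt E (TangentSpace 𝓘(ℝ, E)) p).symmL ℝ
      ((extChartAt 𝓘(ℝ, E) p).symm (β t)) (coordField X p ((extChartAt 𝓘(ℝ, E) p).symm (β t))) =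
      X ((extChartAt 𝓘(ℝ, E) p).symm (β t)) :=
    (Trivialization.symmL_apply _ hq _).trans
      ((trivializationAt E (TangentSpace 𝓘(ℝ, E)) p).symm_apply_apply_mk hq (X _))
  ext
  rw [← h5]
  change (trivializationAt E (TangentSpace 𝓘(ℝ, E)) p).symmL ℝ
      ((extChartAt 𝓘(ℝ, E) p).symm (β t))
      ((1 : ℝ) • (coordField X p ((extChartAt 𝓘(ℝ, E) p).symm (β t)))) = (1 : ℝ) • X _
  rw [one_smul, one_smul, h7]

/-- The flow of a smooth vector field is defined and smooth near `(0, p)`. -/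
lemma contMDiffAt_flow_zero [FiniteDimensional ℝ E] [T2Space M]
    (hX : ContMDiff 𝓘(ℝ, E) 𝓘(ℝ, E).tangent ∞
      (fun p : M ↦ (⟨p, X p⟩ : TangentBundle 𝓘(ℝ, E) M))) (n : ℕ) (p : M) :
    flowDomain X ∈ 𝓝 ((0 : ℝ), p) ∧ ContMDiffAt (𝓘(ℝ, ℝ).prod 𝓘(ℝ, E)) 𝓘(ℝ, E) n
      (fun z : ℝ × M ↦ flow X z.1 z.2) (0, p) := by
  -- The order is `n + 1` because the local flow theorem needs a nonzero order, while `n = 0` is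
  -- allowed here.
  have hF : ContDiffAt ℝ (n + 1 : ℕ) (coordField X p ∘ (extChartAt 𝓘(ℝ, E) p).symm)
      (extChartAt 𝓘(ℝ, E) p p) :=
    (contDiffAt_coordField_comp_symm hX p).of_le (by exact_mod_cast le_top)
  obtain ⟨φ, hφ, h⟩ := hF.exists_contDiffAt_localFlow (Nat.succ_ne_zero n)
    (extChartAt_target_mem_nhds p)
  have ht : Filter.Tendsto (fun z : ℝ × M ↦ (z.1, extChartAt 𝓘(ℝ, E) p z.2)) (𝓝 ((0 : ℝ), p))
      (𝓝 (0, extChartAt 𝓘(ℝ, E) p p)) :=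
    (continuousAt_fst.prodMk ((continuousAt_extChartAt p).comp
      (x := ((0 : ℝ), p)) continuousAt_snd))
  have key : ∀ᶠ z in 𝓝 ((0 : ℝ), p), z ∈ flowDomain X ∧
      flow X z.1 z.2 = (extChartAt 𝓘(ℝ, E) p).symm (φ (z.1, extChartAt 𝓘(ℝ, E) p z.2)) := by
    have hsrc : ∀ᶠ z in 𝓝 ((0 : ℝ), p), z.2 ∈ (extChartAt 𝓘(ℝ, E) p).source :=
      continuousAt_snd.preimage_mem_nhds (extChartAt_source_mem_nhds p)
    filter_upwards [ht.eventually h, hsrc] with z hz hzs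
    obtain ⟨β, hβ0, hβz, r, hr, hβ⟩ := hz
    have hc := isMIntegralCurveOn_symm_comp (X := X) (p := p) hβ
    have hr0 : 0 < r := (abs_nonneg _).trans_lt hr
    have k := flow_eq_of_isMIntegralCurveOn hX (t := z.1) ⟨neg_lt_zero.2 hr0, hr0⟩
      (abs_lt.1 hr) hc
    simp only [Function.comp_apply, hβ0, hβz, (extChartAt 𝓘(ℝ, E) p).left_inv hzs] at k
    exact k
  refine ⟨key.mono fun z hz ↦ hz.1, ?_⟩
  refine ContMDiffAt.congr_of_eventuallyEq ?_ (key.mono fun z hz ↦ hz.2)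
  have hφ0 : φ (0, extChartAt 𝓘(ℝ, E) p p) = extChartAt 𝓘(ℝ, E) p p := by
    obtain ⟨β, hβ0, hβz, -⟩ := h.self_of_nhds
    exact hβz.symm.trans hβ0
  have h1 : ContMDiffAt (𝓘(ℝ, ℝ).prod 𝓘(ℝ, E)) (𝓘(ℝ, ℝ).prod 𝓘(ℝ, E)) n
      (fun z : ℝ × M ↦ (z.1, extChartAt 𝓘(ℝ, E) p z.2)) (0, p) :=
    contMDiffAt_fst.prodMk (ContMDiffAt.comp ((0 : ℝ), p)
      (contMDiffAt_extChartAt (x := p)) contMDiffAt_snd)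
  have h2 : ContMDiffAt (𝓘(ℝ, ℝ).prod 𝓘(ℝ, E)) 𝓘(ℝ, E) n φ (0, extChartAt 𝓘(ℝ, E) p p) := by
    rw [← modelWithCornersSelf_prod, chartedSpaceSelf_prod]
    exact (hφ.of_le (by exact_mod_cast Nat.le_succ n)).contMDiffAt
  have h3 : ContMDiffAt 𝓘(ℝ, E) 𝓘(ℝ, E) n (extChartAt 𝓘(ℝ, E) p).symm
      (φ (0, extChartAt 𝓘(ℝ, E) p p)) := by
    rw [hφ0]
    exact ((contMDiffOn_extChartAt_symm (n := ∞) p).contMDiffAt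
      (extChartAt_target_mem_nhds p)).of_le (by exact_mod_cast le_top)
  exact h3.comp (0, p) (h2.comp (0, p) h1)

lemma hasMFDerivAt_flow_left [T2Space M]
    (hX : ContMDiff 𝓘(ℝ, E) 𝓘(ℝ, E).tangent ∞
      (fun p : M ↦ (⟨p, X p⟩ : TangentBundle 𝓘(ℝ, E) M))) {t : ℝ} {p : M}
    (h : (t, p) ∈ flowDomain X) :
    HasMFDerivAt 𝓘(ℝ, ℝ) 𝓘(ℝ, E) (fun s ↦ flow X s p) t
      ((1 : ℝ →L[ℝ] ℝ).smulRight <| X (flow X t p)) := by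
  obtain ⟨a, b, -, ht, -, -, hγ⟩ := exists_isMIntegralCurveOn_flow hX h
  exact (hγ t ht).hasMFDerivAt (isOpen_Ioo.mem_nhds ht)

end FlowSmooth

end RiemannianGronwall

namespace RiemannianGronwall

/-! ### Smoothness of the flow on its whole domain -/

section FlowSmoothGlobal

variable {E : Type*} [NormedAddCommGroup E] [NormedSpace ℝ E] [FiniteDimensional ℝ E]
  {M : Type*} [TopologicalSpace M] [ChartedSpace E M] [IsManifold 𝓘(ℝ, E) ∞ M] [T2Space M]
  {X : ∀ p : M, TangentSpace 𝓘(ℝ, E) p}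

/-- Being `C^n` at a point spreads to a neighbourhood for finite `n`; this is why the flow is
treated one finite order at a time. -/
lemma eventually_contMDiffAt_flow
    (hX : ContMDiff 𝓘(ℝ, E) 𝓘(ℝ, E).tangent ∞
      (fun p : M ↦ (⟨p, X p⟩ : TangentBundle 𝓘(ℝ, E) M))) (n : ℕ) (p : M) :
    ∀ᶠ z in 𝓝 ((0 : ℝ), p), z ∈ flowDomain X ∧
      ContMDiffAt (𝓘(ℝ, ℝ).prod 𝓘(ℝ, E)) 𝓘(ℝ, E) n (fun z : ℝ × M ↦ flow X z.1 z.2) z := by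
  obtain ⟨h1, h2⟩ := contMDiffAt_flow_zero hX n p
  have : IsManifold 𝓘(ℝ, E) n M := IsManifold.of_le (n := ∞) (by exact_mod_cast le_top)
  exact Filter.Eventually.and h1 ((contMDiffAt_iff_contMDiffAt_nhds (by simp)).1 h2)

/-- The flow of a smooth vector field has an open domain, on which it is smooth. -/
theorem contMDiffAt_flow
    (hX : ContMDiff 𝓘(ℝ, E) 𝓘(ℝ, E).tangent ∞
      (fun p : M ↦ (⟨p, X p⟩ : TangentBundle 𝓘(ℝ, E) M))) (n : ℕ) {t : ℝ} {p : M}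
    (h : (t, p) ∈ flowDomain X) :
    flowDomain X ∈ 𝓝 (t, p) ∧ ContMDiffAt (𝓘(ℝ, ℝ).prod 𝓘(ℝ, E)) 𝓘(ℝ, E) n
      (fun z : ℝ × M ↦ flow X z.1 z.2) (t, p) := by
  obtain ⟨a, b, h0, ht, hab, hp, hγ⟩ := exists_isMIntegralCurveOn_flow hX h
  let P : ℝ → Prop := fun t ↦ flowDomain X ∈ 𝓝 (t, p) ∧
    ContMDiffAt (𝓘(ℝ, ℝ).prod 𝓘(ℝ, E)) 𝓘(ℝ, E) n (fun z : ℝ × M ↦ flow X z.1 z.2) (t, p)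
  suffices H : P 0 → P t from H (contMDiffAt_flow_zero hX n p)
  -- Continuation along the integral curve: it suffices that, near each time `t₀`, the property
  -- passes between `t₀` and nearby times in both directions.
  refine isPreconnected_Ioo.induction₂' (fun s t ↦ P s → P t) ?_
    (fun x y z _ _ _ hxy hyz hx ↦ hyz (hxy hx)) h0 ht
  intro t₀ ht₀
  obtain ⟨S, hS, U, hU, hSU⟩ := mem_nhds_prod_iff.1
    (eventually_contMDiffAt_flow hX n (flow X t₀ p))
  obtain ⟨δ, hδ, hδS⟩ := Metric.mem_nhds_iff.1 hS
  have hcont : ContinuousAt (fun s ↦ flow X s p) t₀ :=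
    (hγ.continuousOn t₀ ht₀).continuousAt (isOpen_Ioo.mem_nhds ht₀)
  -- Near `(t₂, p)` the flow is the flow for time `t₁`, smooth near `p` by assumption, followed by
  -- the short-time flow near `flow X t₀ p`.
  have step {t₁ t₂ : ℝ} (h1 : |t₂ - t₁| < δ) (h2 : flow X t₁ p ∈ interior U) (hP : P t₁) :
      P t₂ := by
    obtain ⟨hd, hc⟩ := hP
    have hinc : Filter.Tendsto (fun z : ℝ × M ↦ (t₁, z.2)) (𝓝 (t₂, p)) (𝓝 (t₁, p)) :=
      (continuous_const.prodMk continuous_snd).tendsto' _ _ rfl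
    have hG : ContMDiffAt (𝓘(ℝ, ℝ).prod 𝓘(ℝ, E)) (𝓘(ℝ, ℝ).prod 𝓘(ℝ, E)) n
        (fun z : ℝ × M ↦ (z.1 - t₁, flow X t₁ z.2)) (t₂, p) := by
      have h3 : ContMDiffAt (𝓘(ℝ, ℝ).prod 𝓘(ℝ, E)) (𝓘(ℝ, ℝ).prod 𝓘(ℝ, E)) n
          (fun z : ℝ × M ↦ (t₁, z.2)) (t₂, p) := contMDiffAt_const.prodMk contMDiffAt_snd
      have h4 : ContMDiffAt (𝓘(ℝ, ℝ).prod 𝓘(ℝ, E)) 𝓘(ℝ, ℝ) n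
          (fun z : ℝ × M ↦ z.1 - t₁) (t₂, p) := contMDiffAt_fst.sub contMDiffAt_const
      exact h4.prodMk (ContMDiffAt.comp (t₂, p) (g := fun z : ℝ × M ↦ flow X z.1 z.2)
        (f := fun z : ℝ × M ↦ (t₁, z.2)) hc h3)
    have hmem : (t₂ - t₁, flow X t₁ p) ∈ S ×ˢ U :=
      ⟨hδS (mem_ball_zero_iff.2 h1), interior_subset h2⟩
    have hSUmem : ∀ᶠ z in 𝓝 (t₂, p), (z.1 - t₁, flow X t₁ z.2) ∈ S ×ˢ U := by
      refine hG.continuousAt.preimage_mem_nhds (prod_mem_nhds ?_ ?_)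
      · exact Filter.mem_of_superset (Metric.isOpen_ball.mem_nhds (mem_ball_zero_iff.2 h1)) hδS
      · exact mem_interior_iff_mem_nhds.1 h2
    have key : ∀ᶠ z in 𝓝 (t₂, p), z ∈ flowDomain X ∧
        flow X z.1 z.2 = flow X (z.1 - t₁) (flow X t₁ z.2) := by
      filter_upwards [hSUmem, hinc.eventually hd] with z hz1 hz2
      have := flow_add hX hz2 (hSU hz1).1
      rwa [sub_add_cancel] at this
    refine ⟨key.mono fun z hz ↦ hz.1, ?_⟩
    exact (ContMDiffAt.comp (t₂, p) (g := fun z : ℝ × M ↦ flow X z.1 z.2) (hSU hmem).2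
      hG).congr_of_eventuallyEq (key.mono fun z hz ↦ hz.2)
  refine Filter.Eventually.filter_mono nhdsWithin_le_nhds ?_
  filter_upwards [Metric.ball_mem_nhds t₀ hδ,
    hcont.preimage_mem_nhds (interior_mem_nhds.2 hU)] with t₁ h1 h2
  rw [Metric.mem_ball, Real.dist_eq] at h1
  exact ⟨step h1 (mem_interior_iff_mem_nhds.2 hU), step (by rwa [abs_sub_comm]) h2⟩

lemma flow_zero
    (hX : ContMDiff 𝓘(ℝ, E) 𝓘(ℝ, E).tangent ∞
      (fun p : M ↦ (⟨p, X p⟩ : TangentBundle 𝓘(ℝ, E) M))) (p : M) : flow X 0 p = p := by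
  have h : ((0 : ℝ), p) ∈ flowDomain X := mem_of_mem_nhds (contMDiffAt_flow_zero hX 1 p).1
  obtain ⟨-, -, -, -, -, hp, -⟩ := exists_isMIntegralCurveOn_flow hX h
  exact hp

lemma contMDiffAt_flow_right
    (hX : ContMDiff 𝓘(ℝ, E) 𝓘(ℝ, E).tangent ∞
      (fun p : M ↦ (⟨p, X p⟩ : TangentBundle 𝓘(ℝ, E) M))) (n : ℕ) {t : ℝ} {p : M}
    (h : (t, p) ∈ flowDomain X) : ContMDiffAt 𝓘(ℝ, E) 𝓘(ℝ, E) n (flow X t) p :=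
  ContMDiffAt.comp p (g := fun z : ℝ × M ↦ flow X z.1 z.2) (f := fun q ↦ (t, q))
    (contMDiffAt_flow hX n h).2 (contMDiffAt_const.prodMk contMDiffAt_id)

end FlowSmoothGlobal

end RiemannianGronwall

/-! ### Two calculus lemmas -/

/-- The derivative of a curve of bilinear forms evaluated along a curve of vectors. -/
lemma hasDerivAt_bilin_apply_self {V : Type*} [NormedAddCommGroup V] [NormedSpace ℝ V]
    [FiniteDimensional ℝ V] {B : ℝ → V →ₗ[ℝ] V →ₗ[ℝ] ℝ} {B' : V → V → ℝ} {η : ℝ → V} {η' : V}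
    {t : ℝ} (hB : ∀ u w, HasDerivAt (fun s ↦ B s u w) (B' u w) t) (hη : HasDerivAt η η' t) :
    HasDerivAt (fun s ↦ B s (η s) (η s)) (B' (η t) (η t) + B t η' (η t) + B t (η t) η') t := by
  let b := Module.finBasis ℝ V
  have key (s : ℝ) (u w : V) :
      B s u w = ∑ i, ∑ j, b.repr u i * (b.repr w j * B s (b i) (b j)) := by
    conv_lhs => rw [← b.sum_repr u, ← b.sum_repr w]
    simp only [map_sum, LinearMap.sum_apply, map_smul, LinearMap.smul_apply, smul_eq_mul,
      Finset.mul_sum]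
    rw [Finset.sum_comm]
    exact Finset.sum_congr rfl fun i _ ↦ Finset.sum_congr rfl fun j _ ↦ by ring
  have hc (i) : HasDerivAt (fun s ↦ b.repr (η s) i) (b.repr η' i) t :=
    (LinearMap.toContinuousLinearMap (b.coord i)).hasFDerivAt.comp_hasDerivAt t hη
  -- `B'` is only a function of two vectors; its expansion in the basis follows from uniqueness of
  -- derivatives.
  have hB' (u w : V) : B' u w = ∑ i, ∑ j, b.repr u i * (b.repr w j * B' (b i) (b j)) := by
    refine (hB u w).unique ?_
    simp only [key _ u w]
    exact HasDerivAt.fun_sum fun i _ ↦ HasDerivAt.fun_sum fun j _ ↦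
      ((hB _ _).const_mul _).const_mul _
  have hd : HasDerivAt (fun s ↦ ∑ i, ∑ j, b.repr (η s) i * (b.repr (η s) j * B s (b i) (b j)))
      (∑ i, ∑ j, (b.repr η' i * (b.repr (η t) j * B t (b i) (b j)) + b.repr (η t) i *
        (b.repr η' j * B t (b i) (b j) + b.repr (η t) j * B' (b i) (b j)))) t :=
    HasDerivAt.fun_sum fun i _ ↦ HasDerivAt.fun_sum fun j _ ↦
      (hc i).mul ((hc j).mul (hB _ _))
  simp only [← key] at hd
  refine hd.congr_deriv ?_
  rw [key t η', key t (η t) η', hB']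
  simp only [← Finset.sum_add_distrib]
  exact Finset.sum_congr rfl fun i _ ↦ Finset.sum_congr rfl fun j _ ↦ by ring

/-- The mixed second derivatives of a `C²` function of a real variable and a vector commute. -/
lemma hasDerivAt_fderiv_right_of_contDiffAt {E F : Type*} [NormedAddCommGroup E]
    [NormedSpace ℝ E] [NormedAddCommGroup F] [NormedSpace ℝ F] {ψ : ℝ × E → F} {y₀ : E}
    {t : ℝ} (hψ : ContDiffAt ℝ 2 ψ (t, y₀)) {Y : E → F}
    (hY : ∀ᶠ y in 𝓝 y₀, HasDerivAt (fun s ↦ ψ (s, y)) (Y y) t) (w : E) :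
    HasDerivAt (fun s ↦ fderiv ℝ (fun y ↦ ψ (s, y)) y₀ w) (fderiv ℝ Y y₀ w) t := by
  have hev : ∀ᶠ z in 𝓝 (t, y₀), DifferentiableAt ℝ ψ z :=
    (hψ.eventually (by simp)).mono fun z hz ↦ hz.differentiableAt (by simp)
  have hD : HasFDerivAt (fderiv ℝ ψ) (fderiv ℝ (fderiv ℝ ψ) (t, y₀)) (t, y₀) :=
    ((hψ.fderiv_right (m := 1) (by norm_num)).differentiableAt (by simp)).hasFDerivAt
  -- Both mixed derivatives are values of the second derivative of `ψ` on `(1, 0)` and `(0, w)`, in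
  -- opposite orders.
  have hsymm : IsSymmSndFDerivAt ℝ ψ (t, y₀) := hψ.isSymmSndFDerivAt (by simp)
  have h1 : HasFDerivAt Y (((ContinuousLinearMap.apply ℝ F ((1 : ℝ), (0 : E))) ∘L
      fderiv ℝ (fderiv ℝ ψ) (t, y₀)) ∘L .inr ℝ ℝ E) y₀ := by
    have h2 : HasFDerivAt (fun y ↦ fderiv ℝ ψ (t, y) ((1 : ℝ), (0 : E)))
        (((ContinuousLinearMap.apply ℝ F ((1 : ℝ), (0 : E))) ∘L
          fderiv ℝ (fderiv ℝ ψ) (t, y₀)) ∘L .inr ℝ ℝ E) y₀ :=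
      ((ContinuousLinearMap.apply ℝ F ((1 : ℝ), (0 : E))).hasFDerivAt.comp (t, y₀) hD).comp y₀
        (hasFDerivAt_prodMk_right t y₀)
    refine h2.congr_of_eventuallyEq ?_
    have hev' : ∀ᶠ y in 𝓝 y₀, DifferentiableAt ℝ ψ (t, y) :=
      ((Continuous.prodMk_right t).tendsto y₀).eventually hev
    filter_upwards [hY, hev'] with y hy hy'
    refine hy.unique ?_
    have := hy'.hasFDerivAt.comp t (hasFDerivAt_prodMk_left (𝕜 := ℝ) t y)
    exact this.hasDerivAt
  have h3 : HasDerivAt (fun s ↦ fderiv ℝ ψ (s, y₀) ((0 : ℝ), w))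
      (fderiv ℝ (fderiv ℝ ψ) (t, y₀) ((1 : ℝ), (0 : E)) ((0 : ℝ), w)) t := by
    have h4 := ((ContinuousLinearMap.apply ℝ F ((0 : ℝ), w)).hasFDerivAt.comp (t, y₀) hD).comp t
      (hasFDerivAt_prodMk_left (𝕜 := ℝ) t y₀)
    exact h4.hasDerivAt
  rw [h1.fderiv]
  have h4 : HasDerivAt (fun s ↦ fderiv ℝ (fun y ↦ ψ (s, y)) y₀ w)
      (fderiv ℝ (fderiv ℝ ψ) (t, y₀) ((1 : ℝ), (0 : E)) ((0 : ℝ), w)) t := by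
    refine h3.congr_of_eventuallyEq ?_
    have hev' : ∀ᶠ s in 𝓝 t, DifferentiableAt ℝ ψ (s, y₀) :=
      ((Continuous.prodMk_left y₀).tendsto t).eventually hev
    filter_upwards [hev'] with s hs
    have := hs.hasFDerivAt.comp y₀ (hasFDerivAt_prodMk_right s y₀)
    exact congrArg (fun L ↦ L w) this.fderiv
  refine h4.congr_deriv ?_
  exact hsymm _ _

namespace RiemannianGronwall

/-! ### The variational equation in a chart -/

section Variation

variable {E : Type*} [NormedAddCommGroup E] [NormedSpace ℝ E] [FiniteDimensional ℝ E]
  {M : Type*} [TopologicalSpace M] [ChartedSpace E M] [IsManifold 𝓘(ℝ, E) ∞ M] [T2Space M]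
  {X : ∀ p : M, TangentSpace 𝓘(ℝ, E) p}

omit [FiniteDimensional ℝ E] [T2Space M] [IsManifold 𝓘(ℝ, E) ∞ M] in
lemma hasDerivAt_comp_curve {F : Type*} [NormedAddCommGroup F] [NormedSpace ℝ F]
    {γ : ℝ → M} {t : ℝ} {w : TangentSpace 𝓘(ℝ, E) (γ t)}
    (hγ : HasMFDerivAt 𝓘(ℝ, ℝ) 𝓘(ℝ, E) γ t ((1 : ℝ →L[ℝ] ℝ).smulRight w)) {f : M → F}
    (hf : MDifferentiableAt 𝓘(ℝ, E) 𝓘(ℝ, F) f (γ t)) :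
    HasDerivAt (fun s ↦ f (γ s)) (mvfderiv 𝓘(ℝ, E) f (γ t) w) t := by
  have h : HasFDerivAt (f ∘ γ) (mfderiv 𝓘(ℝ, E) 𝓘(ℝ, F) f (γ t) ∘L
      (1 : ℝ →L[ℝ] ℝ).smulRight w : ℝ →L[ℝ] F) t := (hf.hasMFDerivAt.comp t hγ).hasFDerivAt
  refine h.hasDerivAt.congr_deriv ?_
  change mfderiv 𝓘(ℝ, E) 𝓘(ℝ, F) f (γ t) ((1 : ℝ) • w) = _
  rw [one_smul]; rfl

lemma hasDerivAt_comp_flow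
    (hX : ContMDiff 𝓘(ℝ, E) 𝓘(ℝ, E).tangent ∞
      (fun p : M ↦ (⟨p, X p⟩ : TangentBundle 𝓘(ℝ, E) M)))
    {F : Type*} [NormedAddCommGroup F] [NormedSpace ℝ F] {f : M → F} {p : M}
    (hf : MDifferentiableAt 𝓘(ℝ, E) 𝓘(ℝ, F) f p) :
    HasDerivAt (fun s ↦ f (flow X s p)) (mvfderiv 𝓘(ℝ, E) f p (X p)) 0 := by
  have h0 := flow_zero hX p
  have h := hasDerivAt_comp_curve (f := f)
    (hasMFDerivAt_flow_left hX (mem_of_mem_nhds (contMDiffAt_flow_zero hX 1 p).1))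
    (by rwa [h0])
  rwa [h0] at h

/-- The differential of the flow, read in the chart at `p`, satisfies the variational equation at
time zero. -/
lemma hasDerivAt_mvfderiv_chart_flow
    (hX : ContMDiff 𝓘(ℝ, E) 𝓘(ℝ, E).tangent ∞
      (fun p : M ↦ (⟨p, X p⟩ : TangentBundle 𝓘(ℝ, E) M))) (p : M) (v : TangentSpace 𝓘(ℝ, E) p) :
    HasDerivAt (fun s ↦ mvfderiv 𝓘(ℝ, E) (fun q ↦ extChartAt 𝓘(ℝ, E) p (flow X s q)) p v)
      (mvfderiv 𝓘(ℝ, E) (coordField X p) p v) 0 := by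
  let y₀ := extChartAt 𝓘(ℝ, E) p p
  let ψ : ℝ × E → E := fun z ↦
    extChartAt 𝓘(ℝ, E) p (flow X z.1 ((extChartAt 𝓘(ℝ, E) p).symm z.2))
  have hsymm : ContMDiffAt 𝓘(ℝ, E) 𝓘(ℝ, E) 2 (extChartAt 𝓘(ℝ, E) p).symm y₀ :=
    ((contMDiffOn_extChartAt_symm (n := ∞) p).contMDiffAt
      (extChartAt_target_mem_nhds p)).of_le (by norm_cast)
  have hp : (extChartAt 𝓘(ℝ, E) p).symm y₀ = p := extChartAt_to_inv p
  have hflow0 := flow_zero hX p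
  have hψ : ContDiffAt ℝ 2 ψ (0, y₀) := by
    have h1 : ContMDiffAt (𝓘(ℝ, ℝ).prod 𝓘(ℝ, E)) (𝓘(ℝ, ℝ).prod 𝓘(ℝ, E)) 2
        (fun z : ℝ × E ↦ (z.1, (extChartAt 𝓘(ℝ, E) p).symm z.2)) (0, y₀) :=
      contMDiffAt_fst.prodMk (ContMDiffAt.comp ((0 : ℝ), y₀) hsymm contMDiffAt_snd)
    have h2 : ContMDiffAt (𝓘(ℝ, ℝ).prod 𝓘(ℝ, E)) 𝓘(ℝ, E) 2
        (fun z : ℝ × E ↦ flow X z.1 ((extChartAt 𝓘(ℝ, E) p).symm z.2)) (0, y₀) :=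
      ContMDiffAt.comp ((0 : ℝ), y₀) (g := fun z : ℝ × M ↦ flow X z.1 z.2)
        (by rw [hp]; exact (contMDiffAt_flow_zero hX 2 p).2) h1
    have h3 : ContMDiffAt (𝓘(ℝ, ℝ).prod 𝓘(ℝ, E)) 𝓘(ℝ, E) 2 ψ (0, y₀) := by
      refine ContMDiffAt.comp ((0 : ℝ), y₀) (g := extChartAt 𝓘(ℝ, E) p) ?_ h2
      simp only [hp, hflow0]
      exact contMDiffAt_extChartAt
    rw [← modelWithCornersSelf_prod, chartedSpaceSelf_prod] at h3
    exact h3.contDiffAt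
  -- The velocity of the flow in the chart is the component function of `X`, because the
  -- differential of the chart is the trivialization at `p`.
  have hY : ∀ᶠ y in 𝓝 y₀, HasDerivAt (fun s ↦ ψ (s, y))
      (coordField X p ((extChartAt 𝓘(ℝ, E) p).symm y)) 0 := by
    filter_upwards [extChartAt_target_mem_nhds (I := 𝓘(ℝ, E)) p] with y hy
    have hq : (extChartAt 𝓘(ℝ, E) p).symm y ∈ (chartAt E p).source := by
      simpa using (extChartAt 𝓘(ℝ, E) p).map_target hy
    refine (hasDerivAt_comp_flow hX (mdifferentiableAt_extChartAt hq)).congr_deriv ?_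
    have := TangentBundle.continuousLinearMapAt_trivializationAt (I := 𝓘(ℝ, E)) hq
    change mfderiv 𝓘(ℝ, E) 𝓘(ℝ, E) (extChartAt 𝓘(ℝ, E) p) _ _ = _
    rw [← this]
    exact (trivializationAt E (TangentSpace 𝓘(ℝ, E)) p).continuousLinearMapAt_apply_of_mem ℝ hq _
  have hmain := hasDerivAt_fderiv_right_of_contDiffAt hψ hY
    (mfderiv 𝓘(ℝ, E) 𝓘(ℝ, E) (extChartAt 𝓘(ℝ, E) p) p v)
  have hchart : MDifferentiableAt 𝓘(ℝ, E) 𝓘(ℝ, E) (extChartAt 𝓘(ℝ, E) p) p :=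
    mdifferentiableAt_extChartAt (mem_chart_source E p)
  have hfac {F : Type _} [NormedAddCommGroup F] [NormedSpace ℝ F] {f : M → F} {f' : E → F}
      (hf' : DifferentiableAt ℝ f' y₀) (hff' : f =ᶠ[𝓝 p] f' ∘ extChartAt 𝓘(ℝ, E) p) :
      mvfderiv 𝓘(ℝ, E) f p v =
        fderiv ℝ f' y₀ (mfderiv 𝓘(ℝ, E) 𝓘(ℝ, E) (extChartAt 𝓘(ℝ, E) p) p v) := by
    rw [mvfderiv_congr hff']
    have h := (hf'.hasFDerivAt.hasMFDerivAt).comp p hchart.hasMFDerivAt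
    exact congrArg (fun L ↦ L v) h.mfderiv
  have hleft : ∀ᶠ q in 𝓝 p, (extChartAt 𝓘(ℝ, E) p).symm (extChartAt 𝓘(ℝ, E) p q) = q := by
    filter_upwards [extChartAt_source_mem_nhds (I := 𝓘(ℝ, E)) p] with q hq
    exact (extChartAt 𝓘(ℝ, E) p).left_inv hq
  have e1 : mvfderiv 𝓘(ℝ, E) (coordField X p) p v =
      fderiv ℝ (fun y ↦ coordField X p ((extChartAt 𝓘(ℝ, E) p).symm y)) y₀
        (mfderiv 𝓘(ℝ, E) 𝓘(ℝ, E) (extChartAt 𝓘(ℝ, E) p) p v) :=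
    hfac ((contDiffAt_coordField_comp_symm hX p).differentiableAt (by simp))
      (hleft.mono fun q hq ↦ by simp only [Function.comp_apply, hq])
  rw [e1]
  refine hmain.congr_of_eventuallyEq ?_
  have hev : ∀ᶠ s in 𝓝 (0 : ℝ), DifferentiableAt ℝ ψ (s, y₀) :=
    ((Continuous.prodMk_left y₀).tendsto (0 : ℝ)).eventually
      ((hψ.eventually (by simp)).mono fun z hz ↦ hz.differentiableAt (by simp))
  filter_upwards [hev] with s hs
  exact hfac (f' := fun y ↦ ψ (s, y)) (hs.comp y₀ (hasFDerivAt_prodMk_right s y₀).differentiableAt)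
    (hleft.mono fun q hq ↦ by simp only [ψ, Function.comp_apply, hq])

end Variation

end RiemannianGronwall

namespace RiemannianGronwall

/-! ### First variation of the norm and the Gronwall estimate -/

section NormDerivative

variable {E : Type*} [NormedAddCommGroup E] [NormedSpace ℝ E] [FiniteDimensional ℝ E]
  {M : Type*} [TopologicalSpace M] [ChartedSpace E M] [IsManifold 𝓘(ℝ, E) ∞ M] [T2Space M]
  {X : ∀ p : M, TangentSpace 𝓘(ℝ, E) p}

-- Both sides have the constant components `u` in the trivialization at `p`; hence `dMetric`
-- differentiates the metric coefficients in this frame.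
omit [FiniteDimensional ℝ E] [T2Space M] in
lemma extend_symmL {p q : M}
    (hq : q ∈ (trivializationAt E (TangentSpace 𝓘(ℝ, E)) p).baseSet) (u : E) :
    FiberBundle.extend E ((trivializationAt E (TangentSpace 𝓘(ℝ, E)) p).symmL ℝ p u) q =
      (trivializationAt E (TangentSpace 𝓘(ℝ, E)) p).symmL ℝ q u := by
  have hp : p ∈ (trivializationAt E (TangentSpace 𝓘(ℝ, E)) p).baseSet :=
    FiberBundle.mem_baseSet_trivializationAt' p
  rw [Trivialization.symmL_apply _ hq, FiberBundle.extend]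
  congr 1
  rw [← Trivialization.continuousLinearMapAt_apply_of_mem ℝ _ hp]
  exact Trivialization.continuousLinearMapAt_symmL _ hp u

/-- Tangent vectors transported by the flow are recovered from their components in a chart. -/
lemma eventually_symmL_mvfderiv_flow
    (hX : ContMDiff 𝓘(ℝ, E) 𝓘(ℝ, E).tangent ∞
      (fun p : M ↦ (⟨p, X p⟩ : TangentBundle 𝓘(ℝ, E) M))) (p : M) (v : TangentSpace 𝓘(ℝ, E) p) :
    ∀ᶠ s in 𝓝 (0 : ℝ), flow X s p ∈ (trivializationAt E (TangentSpace 𝓘(ℝ, E)) p).baseSet ∧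
      (trivializationAt E (TangentSpace 𝓘(ℝ, E)) p).symmL ℝ (flow X s p)
        (mvfderiv 𝓘(ℝ, E) (fun q ↦ extChartAt 𝓘(ℝ, E) p (flow X s q)) p v) =
      mfderiv 𝓘(ℝ, E) 𝓘(ℝ, E) (flow X s) p v := by
  have hd : ((0 : ℝ), p) ∈ flowDomain X := mem_of_mem_nhds (contMDiffAt_flow_zero hX 1 p).1
  have h1 : ∀ᶠ s in 𝓝 (0 : ℝ), (s, p) ∈ flowDomain X :=
    ((Continuous.prodMk_left p).tendsto (0 : ℝ)).eventually (contMDiffAt_flow_zero hX 1 p).1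
  have h2 : ∀ᶠ s in 𝓝 (0 : ℝ), flow X s p ∈ (chartAt E p).source := by
    refine (hasMFDerivAt_flow_left hX hd).continuousAt.preimage_mem_nhds ?_
    rw [flow_zero hX]
    exact chart_source_mem_nhds E p
  filter_upwards [h1, h2] with s hs hq
  refine ⟨hq, ?_⟩
  have h3 : MDifferentiableAt 𝓘(ℝ, E) 𝓘(ℝ, E) (flow X s) p :=
    (contMDiffAt_flow_right hX 1 hs).mdifferentiableAt (by simp)
  have h4 := (mdifferentiableAt_extChartAt (I := 𝓘(ℝ, E)) hq).hasMFDerivAt.comp p h3.hasMFDerivAt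
  have h5 : mvfderiv 𝓘(ℝ, E) (fun q ↦ extChartAt 𝓘(ℝ, E) p (flow X s q)) p v =
      (trivializationAt E (TangentSpace 𝓘(ℝ, E)) p).continuousLinearMapAt ℝ (flow X s p)
        (mfderiv 𝓘(ℝ, E) 𝓘(ℝ, E) (flow X s) p v) := by
    rw [TangentBundle.continuousLinearMapAt_trivializationAt hq]
    exact congrArg (fun L ↦ L v) h4.mfderiv
  rw [h5]
  exact Trivialization.symmL_continuousLinearMapAt _ hq _

variable [RiemannianBundle (fun x : M ↦ TangentSpace 𝓘(ℝ, E) x)]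
  [IsContMDiffRiemannianBundle 𝓘(ℝ, E) ∞ E (fun x : M ↦ TangentSpace 𝓘(ℝ, E) x)]

/-- In the frame at `p` the squared norm is `B s (W s) (W s)`, with `B` the metric coefficients
along the flow line and `W` the components of the transported vector. The product rule gives
`dMetric p (X p) v v` plus twice `g(flatDeriv X p v, v)`, which is the Koszul expression on the
diagonal. -/
lemma hasDerivAt_norm_sq_mfderiv_flow_zero
    (hX : ContMDiff 𝓘(ℝ, E) 𝓘(ℝ, E).tangent ∞
      (fun p : M ↦ (⟨p, X p⟩ : TangentBundle 𝓘(ℝ, E) M))) (p : M) (v : TangentSpace 𝓘(ℝ, E) p) :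
    HasDerivAt (fun s ↦ ‖mfderiv 𝓘(ℝ, E) 𝓘(ℝ, E) (flow X s) p v‖ ^ 2)
      (2 * inner ℝ (leviCivita X p v) v) 0 := by
  let e := trivializationAt E (TangentSpace 𝓘(ℝ, E)) p
  let B : ℝ → E →ₗ[ℝ] E →ₗ[ℝ] ℝ := fun s ↦ (innerₗ (TangentSpace 𝓘(ℝ, E) (flow X s p))).compl₁₂
    (e.symmL ℝ (flow X s p)).toLinearMap (e.symmL ℝ (flow X s p)).toLinearMap
  let W : ℝ → E := fun s ↦ mvfderiv 𝓘(ℝ, E) (fun q ↦ extChartAt 𝓘(ℝ, E) p (flow X s q)) p v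
  have hp : p ∈ e.baseSet := FiberBundle.mem_baseSet_trivializationAt' p
  have hev := eventually_symmL_mvfderiv_flow hX p v
  have hB (u w : E) : HasDerivAt (fun s ↦ B s u w)
      (dMetric p (X p) (e.symmL ℝ p u) (e.symmL ℝ p w)) 0 := by
    have h := hasDerivAt_comp_flow hX (mdiff_inner_extend (e.symmL ℝ p u) (e.symmL ℝ p w))
    refine h.congr_of_eventuallyEq ?_
    filter_upwards [hev] with s hs
    rw [extend_symmL hs.1, extend_symmL hs.1]
    rfl
  have hmain := hasDerivAt_bilin_apply_self hB (hasDerivAt_mvfderiv_chart_flow hX p v)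
  have hW0 : e.symmL ℝ p (W 0) = v := by
    have h0 : (fun q ↦ extChartAt 𝓘(ℝ, E) p (flow X 0 q)) = extChartAt 𝓘(ℝ, E) p := by
      funext q; rw [flow_zero hX]
    have h1 : W 0 = e.continuousLinearMapAt ℝ p v := by
      rw [TangentBundle.continuousLinearMapAt_trivializationAt (mem_chart_source E p)]
      change mvfderiv 𝓘(ℝ, E) (fun q ↦ extChartAt 𝓘(ℝ, E) p (flow X 0 q)) p v = _
      rw [h0]; rfl
    rw [h1]
    exact Trivialization.symmL_continuousLinearMapAt _ hp _
  have hB0 (u w : E) : B 0 u w = inner ℝ (e.symmL ℝ p u) (e.symmL ℝ p w) := by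
    change inner ℝ (e.symmL ℝ (flow X 0 p) u) (e.symmL ℝ (flow X 0 p) w) = _
    rw [flow_zero hX]
  refine (hmain.congr_of_eventuallyEq ?_).congr_deriv ?_
  · filter_upwards [hev] with s hs
    rw [← real_inner_self_eq_norm_sq, ← hs.2]
    rfl
  · have hflat : e.symmL ℝ p (mvfderiv 𝓘(ℝ, E) (coordField X p) p v) = flatDeriv X p v := rfl
    have hW0' : e.symmL ℝ p (mvfderiv 𝓘(ℝ, E)
        (fun q ↦ extChartAt 𝓘(ℝ, E) p (flow X 0 q)) p v) = v := hW0
    rw [hB0, hB0, hflat, hW0', real_inner_comm]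
    change _ = 2 * inner ℝ (covDeriv X p v) v
    rw [inner_covDeriv, real_inner_comm v, dMetric_symm p v (X p) v]
    ring

/-- The evolution of the squared length of a tangent vector which is transported by the flow. -/
lemma hasDerivAt_norm_sq_mfderiv_flow
    (hX : ContMDiff 𝓘(ℝ, E) 𝓘(ℝ, E).tangent ∞
      (fun p : M ↦ (⟨p, X p⟩ : TangentBundle 𝓘(ℝ, E) M))) {p : M} (v : TangentSpace 𝓘(ℝ, E) p)
    {t : ℝ} (h : (t, p) ∈ flowDomain X) :
    HasDerivAt (fun s ↦ ‖mfderiv 𝓘(ℝ, E) 𝓘(ℝ, E) (flow X s) p v‖ ^ 2)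
      (2 * inner ℝ (leviCivita X (flow X t p) (mfderiv 𝓘(ℝ, E) 𝓘(ℝ, E) (flow X t) p v))
        (mfderiv 𝓘(ℝ, E) 𝓘(ℝ, E) (flow X t) p v)) t := by
  have h0 := hasDerivAt_norm_sq_mfderiv_flow_zero hX (flow X t p)
    (mfderiv 𝓘(ℝ, E) 𝓘(ℝ, E) (flow X t) p v)
  have h1 : HasDerivAt (fun s ↦ ‖mfderiv 𝓘(ℝ, E) 𝓘(ℝ, E) (flow X (s - t)) (flow X t p)
      (mfderiv 𝓘(ℝ, E) 𝓘(ℝ, E) (flow X t) p v)‖ ^ 2)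
      (2 * inner ℝ (leviCivita X (flow X t p) (mfderiv 𝓘(ℝ, E) 𝓘(ℝ, E) (flow X t) p v))
        (mfderiv 𝓘(ℝ, E) 𝓘(ℝ, E) (flow X t) p v)) t := by
    rw [← sub_self t] at h0
    exact h0.comp_sub_const t t
  refine h1.congr_of_eventuallyEq ?_
  have hd : ∀ᶠ s in 𝓝 t, (s - t, flow X t p) ∈ flowDomain X := by
    have hc : Filter.Tendsto (fun s ↦ (s - t, flow X t p)) (𝓝 t) (𝓝 (0, flow X t p)) :=
      Continuous.tendsto' (by fun_prop) _ _ (by simp)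
    exact hc.eventually (contMDiffAt_flow_zero hX 1 (flow X t p)).1
  filter_upwards [hd] with s hs
  have hft : MDifferentiableAt 𝓘(ℝ, E) 𝓘(ℝ, E) (flow X t) p :=
    (contMDiffAt_flow_right hX 1 h).mdifferentiableAt (by simp)
  have hfs : MDifferentiableAt 𝓘(ℝ, E) 𝓘(ℝ, E) (flow X (s - t)) (flow X t p) :=
    (contMDiffAt_flow_right hX 1 hs).mdifferentiableAt (by simp)
  have hcomp := hfs.hasMFDerivAt.comp p hft.hasMFDerivAt
  -- Differentiating the flow in space requires the group law on a neighbourhood of `p`, not only at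
  -- `p`.
  have heq : flow X s =ᶠ[𝓝 p] flow X (s - t) ∘ flow X t := by
    have hn1 : ∀ᶠ q in 𝓝 p, (t, q) ∈ flowDomain X :=
      ((Continuous.prodMk_right t).tendsto p).eventually (contMDiffAt_flow hX 1 h).1
    have hn2 : ∀ᶠ q in 𝓝 p, (s - t, flow X t q) ∈ flowDomain X :=
      Filter.Tendsto.eventually (f := fun q ↦ (s - t, flow X t q))
        (continuousAt_const.prodMk hft.continuousAt) (contMDiffAt_flow hX 1 hs).1
    filter_upwards [hn1, hn2] with q hq1 hq2
    have := (flow_add hX hq1 hq2).2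
    rwa [sub_add_cancel] at this
  have hps : flow X s p = flow X (s - t) (flow X t p) := heq.self_of_nhds
  have hfin := (hcomp.congr_of_eventuallyEq heq).mfderiv
  -- The two norms live on the fibres over `flow X s p` and `flow X (s - t) (flow X t p)`, points
  -- that are only propositionally equal.
  have htrans : ∀ q q' : M, q = q' → ∀ w : E,
      norm (E := TangentSpace 𝓘(ℝ, E) q) w = norm (E := TangentSpace 𝓘(ℝ, E) q') w := by
    rintro q _ rfl w
    rfl
  rw [hfin]
  exact congrArg (· ^ 2) (htrans _ _ hps _)

/-- The Gronwall estimate for a tangent vector which is transported by the flow. -/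
lemma norm_mfderiv_flow_le
    (hX : ContMDiff 𝓘(ℝ, E) 𝓘(ℝ, E).tangent ∞
      (fun p : M ↦ (⟨p, X p⟩ : TangentBundle 𝓘(ℝ, E) M))) {p : M} (v : TangentSpace 𝓘(ℝ, E) p)
    {T C : ℝ} (h : ∀ t ∈ Icc 0 T, (t, p) ∈ flowDomain X)
    (hC : ∀ t ∈ Icc 0 T, ‖leviCivita X (flow X t p)‖ ≤ C) {t : ℝ} (ht : t ∈ Icc 0 T) :
    ‖mfderiv 𝓘(ℝ, E) 𝓘(ℝ, E) (flow X t) p v‖ ≤ ‖v‖ * Real.exp (C * t) := by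
  have hd (s) (hs : s ∈ Icc 0 T) := hasDerivAt_norm_sq_mfderiv_flow hX v (h s hs)
  -- Gronwall is applied to the squared norm, which is differentiable even at the zero vector; the
  -- rate `2 * C` is halved on taking roots.
  have hg := norm_le_gronwallBound_of_norm_deriv_right_le (a := 0) (b := T) (δ := ‖v‖ ^ 2)
    (K := 2 * C) (ε := 0) (fun s hs ↦ (hd s hs).continuousAt.continuousWithinAt)
    (fun s hs ↦ (hd s (Ico_subset_Icc_self hs)).hasDerivWithinAt) ?_ ?_ t ht
  · rw [sub_zero, gronwallBound_ε0, Real.norm_of_nonneg (by positivity)] at hg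
    refine le_of_sq_le_sq ?_ (by positivity)
    rwa [mul_pow, ← Real.exp_nat_mul, Nat.cast_ofNat, ← mul_assoc]
  · have h0 : flow X 0 = id := funext fun q ↦ flow_zero hX q
    rw [h0]
    simp
  · intro s hs
    rw [add_zero, Real.norm_of_nonneg (by positivity : 0 ≤ ‖mfderiv 𝓘(ℝ, E) 𝓘(ℝ, E) (flow X s) p v‖ ^ 2),
      norm_mul, Real.norm_two]
    have h1 := norm_inner_le_norm (𝕜 := ℝ)
      (leviCivita X (flow X s p) (mfderiv 𝓘(ℝ, E) 𝓘(ℝ, E) (flow X s) p v))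
      (mfderiv 𝓘(ℝ, E) 𝓘(ℝ, E) (flow X s) p v)
    have h2 := (leviCivita X (flow X s p)).le_of_opNorm_le (hC s (Ico_subset_Icc_self hs))
      (mfderiv 𝓘(ℝ, E) 𝓘(ℝ, E) (flow X s) p v)
    nlinarith [norm_nonneg (mfderiv 𝓘(ℝ, E) 𝓘(ℝ, E) (flow X s) p v)]

end NormDerivative

end RiemannianGronwall

/-- In finite dimension continuity on each pair of vectors is continuity in operator norm, so the
norm at `x` plus one is a bound nearby. -/
lemma exists_eventually_norm_apply_le_of_continuousAt {α E F : Type*} [TopologicalSpace α]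
    [NormedAddCommGroup E] [NormedSpace ℝ E] [FiniteDimensional ℝ E]
    [NormedAddCommGroup F] [NormedSpace ℝ F] {B : α → E →L[ℝ] E →L[ℝ] F} {x : α}
    (hB : ∀ u w, ContinuousAt (fun y ↦ B y u w) x) :
    ∃ K, 0 ≤ K ∧ ∀ᶠ y in 𝓝 x, ∀ u w, ‖B y u w‖ ≤ K * ‖u‖ * ‖w‖ := by
  have h : ContinuousAt B x :=
    continuousAt_clm_apply.2 fun u ↦ continuousAt_clm_apply.2 fun w ↦ hB u w
  refine ⟨‖B x‖ + 1, by positivity, ?_⟩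
  let i : NormedAddCommGroup (E →L[ℝ] E →L[ℝ] F) := ContinuousLinearMap.toNormedAddCommGroup
  have hn : ContinuousAt (fun y ↦ ‖B y‖) x := ContinuousAt.norm h
  filter_upwards [hn.eventually_lt_const (lt_add_one ‖B x‖)] with y hy u w
  exact ((B y).le_opNorm₂ u w).trans (by gcongr)

namespace RiemannianGronwall

/-! ### Koszul's formula and local boundedness of the covariant differential -/

section Koszul

variable {E : Type*} [NormedAddCommGroup E] [NormedSpace ℝ E]
  {M : Type*} [TopologicalSpace M] [ChartedSpace E M] [IsManifold 𝓘(ℝ, E) ∞ M]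

/-- The function is the fibre component of the tangent map of `f` along the section `V`, and both
are continuous. -/
lemma continuousAt_mvfderiv_apply {f : M → ℝ} {V : ∀ q : M, TangentSpace 𝓘(ℝ, E) q} {p : M}
    (hf : ContMDiffAt 𝓘(ℝ, E) 𝓘(ℝ, ℝ) ∞ f p)
    (hV : ContMDiffAt 𝓘(ℝ, E) 𝓘(ℝ, E).tangent ∞
      (fun q : M ↦ (⟨q, V q⟩ : TangentBundle 𝓘(ℝ, E) M)) p) :
    ContinuousAt (fun q ↦ mvfderiv 𝓘(ℝ, E) f q (V q)) p := by
  have hf1 : ContMDiffAt 𝓘(ℝ, E) 𝓘(ℝ, ℝ) 1 f p := hf.of_le (by exact_mod_cast le_top)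
  obtain ⟨u, hu, hfu⟩ := (contMDiffAt_iff_contMDiffOn_nhds (by simp)).1 hf1
  obtain ⟨s, hsu, hs, hps⟩ := mem_nhds_iff.1 hu
  have h1 := (hfu.mono hsu).continuousOn_tangentMapWithin le_rfl hs.uniqueMDiffOn
  have h2 : ContinuousAt (fun q : M ↦ tangentMapWithin 𝓘(ℝ, E) 𝓘(ℝ, ℝ) f s ⟨q, V q⟩) p := by
    refine ContinuousAt.comp (f := fun q : M ↦ (⟨q, V q⟩ : TangentBundle 𝓘(ℝ, E) M))
      (g := tangentMapWithin 𝓘(ℝ, E) 𝓘(ℝ, ℝ) f s) ?_ hV.continuousAt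
    exact h1.continuousAt ((hs.preimage (FiberBundle.continuous_proj E _)).mem_nhds hps)
  have h3 := ((contMDiff_snd_tangentBundle_modelSpace ℝ 𝓘(ℝ, ℝ) (n := 0)).continuous.continuousAt).comp h2
  refine h3.congr ?_
  filter_upwards [hs.mem_nhds hps] with q hq
  change mfderivWithin 𝓘(ℝ, E) 𝓘(ℝ, ℝ) f s q (V q) = mfderiv 𝓘(ℝ, E) 𝓘(ℝ, ℝ) f q (V q)
  rw [mfderivWithin_of_isOpen hs hq]

variable [FiniteDimensional ℝ E] [RiemannianBundle (fun x : M ↦ TangentSpace 𝓘(ℝ, E) x)]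
  [IsContMDiffRiemannianBundle 𝓘(ℝ, E) ∞ E (fun x : M ↦ TangentSpace 𝓘(ℝ, E) x)]

/-- The formula of Koszul. -/
lemma two_mul_inner_leviCivita {X V W : ∀ q : M, TangentSpace 𝓘(ℝ, E) q} {p : M}
    (hX : MDiffAt (T% X) p) (hV : MDiffAt (T% V) p) (hW : MDiffAt (T% W) p) :
    2 * inner ℝ (leviCivita X p (V p)) (W p) =
      mvfderiv 𝓘(ℝ, E) (fun q ↦ inner ℝ (X q) (W q)) p (V p)
      + mvfderiv 𝓘(ℝ, E) (fun q ↦ inner ℝ (V q) (W q)) p (X p)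
      - mvfderiv 𝓘(ℝ, E) (fun q ↦ inner ℝ (V q) (X q)) p (W p)
      + inner ℝ (VectorField.mlieBracket 𝓘(ℝ, E) V X p) (W p)
      - inner ℝ (X p) (VectorField.mlieBracket 𝓘(ℝ, E) V W p)
      - inner ℝ (V p) (VectorField.mlieBracket 𝓘(ℝ, E) X W p) := by
  -- Vanishing torsion turns brackets into differences of covariant derivatives, metric
  -- compatibility expands the derivatives of inner products, and all but two equal terms cancel.
  have tor {Y Z : ∀ q : M, TangentSpace 𝓘(ℝ, E) q} (hY : MDiffAt (T% Y) p)
      (hZ : MDiffAt (T% Z) p) : VectorField.mlieBracket 𝓘(ℝ, E) Y Z p =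
        leviCivita Z p (Y p) - leviCivita Y p (Z p) := by
    have h := CovariantDerivative.torsion_apply (leviCivita (E := E) (M := M)) hY hZ
    rw [leviCivita_torsion] at h
    exact (sub_eq_zero.1 h.symm).symm
  have met {U Y Z : ∀ q : M, TangentSpace 𝓘(ℝ, E) q} (hY : MDiffAt (T% Y) p)
      (hZ : MDiffAt (T% Z) p) : mvfderiv 𝓘(ℝ, E) (fun q ↦ inner ℝ (Y q) (Z q)) p (U p) =
        inner ℝ (leviCivita Y p (U p)) (Z p) + inner ℝ (Y p) (leviCivita Z p (U p)) :=
    leviCivita_metric.mvfderiv_inner_eq U hY hZ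
  rw [met hX hW, met hV hW, met hV hX, tor hV hX, tor hV hW, tor hX hW]
  simp only [inner_sub_left, inner_sub_right]
  rw [real_inner_comm (X p), real_inner_comm (leviCivita V p (W p)) (X p)]
  ring

/-- The right side of Koszul's formula involves only derivatives, brackets and inner products of
smooth fields, with no chart depending on the point. -/
lemma continuousAt_inner_leviCivita {X V W : ∀ q : M, TangentSpace 𝓘(ℝ, E) q} {p : M}
    (hX : ContMDiffAt 𝓘(ℝ, E) 𝓘(ℝ, E).tangent ∞
      (fun q : M ↦ (⟨q, X q⟩ : TangentBundle 𝓘(ℝ, E) M)) p)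
    (hV : ContMDiffAt 𝓘(ℝ, E) 𝓘(ℝ, E).tangent ∞
      (fun q : M ↦ (⟨q, V q⟩ : TangentBundle 𝓘(ℝ, E) M)) p)
    (hW : ContMDiffAt 𝓘(ℝ, E) 𝓘(ℝ, E).tangent ∞
      (fun q : M ↦ (⟨q, W q⟩ : TangentBundle 𝓘(ℝ, E) M)) p) :
    ContinuousAt (fun q ↦ inner ℝ (leviCivita X q (V q)) (W q)) p := by
  have : IsManifold 𝓘(ℝ, E) (minSmoothness ℝ 2) M := by
    rw [minSmoothness_of_isRCLikeNormedField]
    infer_instance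
  have : IsManifold 𝓘(ℝ, E) ((⊤ : ℕ∞) + 1) M := inferInstanceAs (IsManifold 𝓘(ℝ, E) ∞ M)
  have inn {Y Z : ∀ q : M, TangentSpace 𝓘(ℝ, E) q}
      (hY : ContMDiffAt 𝓘(ℝ, E) 𝓘(ℝ, E).tangent ∞
        (fun q : M ↦ (⟨q, Y q⟩ : TangentBundle 𝓘(ℝ, E) M)) p)
      (hZ : ContMDiffAt 𝓘(ℝ, E) 𝓘(ℝ, E).tangent ∞
        (fun q : M ↦ (⟨q, Z q⟩ : TangentBundle 𝓘(ℝ, E) M)) p) :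
      ContMDiffAt 𝓘(ℝ, E) 𝓘(ℝ, ℝ) ∞ (fun q ↦ (inner ℝ (Y q) (Z q) : ℝ)) p :=
    ContMDiffAt.inner_bundle (E := fun x : M ↦ TangentSpace 𝓘(ℝ, E) x) (b := fun q : M ↦ q) hY hZ
  have lie {Y Z : ∀ q : M, TangentSpace 𝓘(ℝ, E) q}
      (hY : ContMDiffAt 𝓘(ℝ, E) 𝓘(ℝ, E).tangent ∞
        (fun q : M ↦ (⟨q, Y q⟩ : TangentBundle 𝓘(ℝ, E) M)) p)
      (hZ : ContMDiffAt 𝓘(ℝ, E) 𝓘(ℝ, E).tangent ∞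
        (fun q : M ↦ (⟨q, Z q⟩ : TangentBundle 𝓘(ℝ, E) M)) p) :
      ContMDiffAt 𝓘(ℝ, E) 𝓘(ℝ, E).tangent ∞ (fun q : M ↦
        (⟨q, VectorField.mlieBracket 𝓘(ℝ, E) Y Z q⟩ : TangentBundle 𝓘(ℝ, E) M)) p :=
    ContMDiffAt.mlieBracket_vectorField (m := ⊤) (n := ⊤) hY hZ (by simp)
  have mdiff {Y : ∀ q : M, TangentSpace 𝓘(ℝ, E) q}
      (hY : ContMDiffAt 𝓘(ℝ, E) 𝓘(ℝ, E).tangent ∞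
        (fun q : M ↦ (⟨q, Y q⟩ : TangentBundle 𝓘(ℝ, E) M)) p) :
      ∀ᶠ q in 𝓝 p, MDiffAt (T% Y) q := by
    have h1 := (contMDiffAt_iff_contMDiffAt_nhds (by simp)).1
      (hY.of_le (m := 1) (by exact_mod_cast le_top))
    filter_upwards [h1] with q hq using hq.mdifferentiableAt (by simp)
  have key := ((((((continuousAt_mvfderiv_apply (inn hX hW) hV).add
    (continuousAt_mvfderiv_apply (inn hV hW) hX)).sub
    (continuousAt_mvfderiv_apply (inn hV hX) hW)).add
    (inn (lie hV hX) hW).continuousAt).sub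
    (inn hX (lie hV hW)).continuousAt).sub
    (inn hV (lie hX hW)).continuousAt).div_const 2
  refine key.congr ?_
  filter_upwards [mdiff hX, mdiff hV, mdiff hW] with q h1 h2 h3
  rw [eq_comm, eq_div_iff two_ne_zero, mul_comm]
  exact two_mul_inner_leviCivita h1 h2 h3

omit [FiniteDimensional ℝ E] in
variable (E M) in
lemma isContinuousRiemannianBundle_tangentSpace :
    IsContinuousRiemannianBundle E (fun x : M ↦ TangentSpace 𝓘(ℝ, E) x) := by
  obtain ⟨g, hg, h⟩ := IsContMDiffRiemannianBundle.exists_contMDiff (IB := 𝓘(ℝ, E)) (n := ∞)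
    (F := E) (E := fun x : M ↦ TangentSpace 𝓘(ℝ, E) x)
  exact ⟨g, hg.continuous, h⟩

/-- In a fixed trivialization the forms `g(∇_v X, w)` are bounded near `p` by `K`; the Riemannian
norm controls the components with a constant `D`, whence the bound `K * (D * D)`. -/
lemma eventually_norm_leviCivita_le {X : ∀ q : M, TangentSpace 𝓘(ℝ, E) q} {p : M}
    (hX : ContMDiffAt 𝓘(ℝ, E) 𝓘(ℝ, E).tangent ∞
      (fun q : M ↦ (⟨q, X q⟩ : TangentBundle 𝓘(ℝ, E) M)) p) :
    ∃ C, ∀ᶠ q in 𝓝 p, ‖leviCivita X q‖ ≤ C := by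
  have := isContinuousRiemannianBundle_tangentSpace E M
  let e := trivializationAt E (TangentSpace 𝓘(ℝ, E)) p
  let B (q : M) : E →L[ℝ] E →L[ℝ] ℝ :=
    (innerSL ℝ (E := TangentSpace 𝓘(ℝ, E) q)).bilinearComp
      (leviCivita X q ∘L e.symmL ℝ q) (e.symmL ℝ q)
  have hbase : ∀ᶠ q in 𝓝 p, q ∈ e.baseSet :=
    e.open_baseSet.mem_nhds (FiberBundle.mem_baseSet_trivializationAt' p)
  have hB (u w : E) : ContinuousAt (fun q ↦ B q u w) p := by
    have h := continuousAt_inner_leviCivita hX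
      (FiberBundle.contMDiffAt_extend 𝓘(ℝ, E) E (e.symmL ℝ p u))
      (FiberBundle.contMDiffAt_extend 𝓘(ℝ, E) E (e.symmL ℝ p w))
    refine h.congr ?_
    filter_upwards [hbase] with q hq
    rw [extend_symmL hq, extend_symmL hq]
    rfl
  obtain ⟨D, hD, hDe⟩ := eventually_norm_trivializationAt_lt E
    (fun x : M ↦ TangentSpace 𝓘(ℝ, E) x) p
  obtain ⟨K, hK, hKe⟩ := exists_eventually_norm_apply_le_of_continuousAt hB
  refine ⟨K * (D * D), ?_⟩
  filter_upwards [hbase, hDe, hKe] with q hq hqD hqB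
  refine ContinuousLinearMap.opNorm_le_bound _ (by positivity) fun v ↦ ?_
  -- Testing the form against `∇_v X` itself bounds its squared norm by a multiple of its norm,
  -- which can be divided out unless it is zero.
  set w := leviCivita X q v with hw
  have hle (z : TangentSpace 𝓘(ℝ, E) q) : ‖e.continuousLinearMapAt ℝ q z‖ ≤ D * ‖z‖ :=
    ContinuousLinearMap.le_of_opNorm_le _ hqD.le z
  have hsq : ‖w‖ * ‖w‖ = B q (e.continuousLinearMapAt ℝ q v) (e.continuousLinearMapAt ℝ q w) := by
    change _ = inner ℝ (leviCivita X q (e.symmL ℝ q (e.continuousLinearMapAt ℝ q v)))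
      (e.symmL ℝ q (e.continuousLinearMapAt ℝ q w))
    rw [Trivialization.symmL_continuousLinearMapAt _ hq, Trivialization.symmL_continuousLinearMapAt _ hq,
      ← hw, real_inner_self_eq_norm_mul_norm]
  have h1 : ‖w‖ * ‖w‖ ≤ (K * (D * D) * ‖v‖) * ‖w‖ := by
    calc ‖w‖ * ‖w‖ ≤ ‖B q (e.continuousLinearMapAt ℝ q v) (e.continuousLinearMapAt ℝ q w)‖ :=
          hsq.le.trans (Real.le_norm_self _)
      _ ≤ K * ‖e.continuousLinearMapAt ℝ q v‖ * ‖e.continuousLinearMapAt ℝ q w‖ :=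
          hqB _ _
      _ ≤ K * (D * ‖v‖) * (D * ‖w‖) := by
          gcongr
          · exact hle v
          · exact hle w
      _ = _ := by ring
  rcases (norm_nonneg w).eq_or_lt with h0 | h0
  · rw [← h0]; positivity
  · exact le_of_mul_le_mul_right h1 h0

end Koszul

end RiemannianGronwall

namespace RiemannianGronwall

/-! ### Finiteness of the length of a `C¹` curve -/

section Length

variable {E : Type*} [NormedAddCommGroup E] [NormedSpace ℝ E]
  {M : Type*} [TopologicalSpace M] [ChartedSpace E M] [IsManifold 𝓘(ℝ, E) ∞ M]
  [RiemannianBundle (fun x : M ↦ TangentSpace 𝓘(ℝ, E) x)]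
  [IsContMDiffRiemannianBundle 𝓘(ℝ, E) ∞ E (fun x : M ↦ TangentSpace 𝓘(ℝ, E) x)]

/-- The velocity is the tangent map applied to the unit field on the interval, and its norm is the
root of a continuous inner product. -/
lemma continuousOn_norm_mfderivWithin {c : ℝ → M} {a b : ℝ} (hab : a < b)
    (hc : ContMDiffOn 𝓘(ℝ, ℝ) 𝓘(ℝ, E) 1 c (Icc a b)) :
    ContinuousOn (fun τ ↦ ‖mfderivWithin 𝓘(ℝ, ℝ) 𝓘(ℝ, E) c (Icc a b) τ (1 : ℝ)‖) (Icc a b) := by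
  have := isContinuousRiemannianBundle_tangentSpace E M
  have h1 := hc.continuousOn_tangentMapWithin le_rfl
    (uniqueMDiffOn_iff_uniqueDiffOn.2 (uniqueDiffOn_Icc hab))
  have h2 : Continuous (fun τ : ℝ ↦ (⟨τ, (1 : ℝ)⟩ : TangentBundle 𝓘(ℝ, ℝ) ℝ)) :=
    (contMDiff_vectorSpace_iff_contDiff (V := fun _ : ℝ ↦ (1 : ℝ)) (n := 0)).2
      contDiff_const |>.continuous
  have h3 : ContinuousOn (fun τ ↦ (⟨c τ, mfderivWithin 𝓘(ℝ, ℝ) 𝓘(ℝ, E) c (Icc a b) τ (1 : ℝ)⟩ :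
      TangentBundle 𝓘(ℝ, E) M)) (Icc a b) :=
    h1.comp h2.continuousOn fun τ hτ ↦ hτ
  have h4 := ContinuousOn.inner_bundle (F := E) (E := fun x : M ↦ TangentSpace 𝓘(ℝ, E) x) (b := c)
    h3 h3
  exact h4.sqrt.congr fun τ _ ↦ norm_eq_sqrt_real_inner (F := TangentSpace 𝓘(ℝ, E) (c τ)) _

lemma pathELength_ne_top {c : ℝ → M} {a b : ℝ} (hab : a < b)
    (hc : ContMDiffOn 𝓘(ℝ, ℝ) 𝓘(ℝ, E) 1 c (Icc a b)) :
    Manifold.pathELength 𝓘(ℝ, E) c a b ≠ ⊤ := by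
  rw [Manifold.pathELength_eq_lintegral_mfderivWithin_Icc]
  simp_rw [← ofReal_norm]
  exact ((continuousOn_norm_mfderivWithin hab hc).integrableOn_compact
    isCompact_Icc).lintegral_lt_top.ne

end Length

/-! ### Transported curves, compactness of the swept region, and the length estimate -/

section Transport

variable {E : Type*} [NormedAddCommGroup E] [NormedSpace ℝ E] [FiniteDimensional ℝ E]
  {M : Type*} [TopologicalSpace M] [ChartedSpace E M] [IsManifold 𝓘(ℝ, E) ∞ M] [T2Space M]
  {X : ∀ p : M, TangentSpace 𝓘(ℝ, E) p}

lemma isCompact_image_flow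
    (hX : ContMDiff 𝓘(ℝ, E) 𝓘(ℝ, E).tangent ∞
      (fun p : M ↦ (⟨p, X p⟩ : TangentBundle 𝓘(ℝ, E) M))) {K : Set (ℝ × M)} (hK : IsCompact K)
    (h : K ⊆ flowDomain X) : IsCompact ((fun z : ℝ × M ↦ flow X z.1 z.2) '' K) :=
  hK.image_of_continuousOn fun _ hz ↦ (contMDiffAt_flow hX 1 (h hz)).2.continuousAt.continuousWithinAt

lemma contMDiffOn_transport
    (hX : ContMDiff 𝓘(ℝ, E) 𝓘(ℝ, E).tangent ∞
      (fun p : M ↦ (⟨p, X p⟩ : TangentBundle 𝓘(ℝ, E) M))) {c : ℝ → M} {s : Set ℝ}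
    (hc : ContMDiffOn 𝓘(ℝ, ℝ) 𝓘(ℝ, E) 1 c s) {t : ℝ}
    (h : ∀ τ ∈ s, (t, c τ) ∈ flowDomain X) :
    ContMDiffOn 𝓘(ℝ, ℝ) 𝓘(ℝ, E) 1 (transport X c t) s :=
  fun τ hτ ↦ (contMDiffAt_flow_right hX 1 (h τ hτ)).comp_contMDiffWithinAt τ (hc τ hτ)

lemma mfderivWithin_transport
    (hX : ContMDiff 𝓘(ℝ, E) 𝓘(ℝ, E).tangent ∞
      (fun p : M ↦ (⟨p, X p⟩ : TangentBundle 𝓘(ℝ, E) M))) {c : ℝ → M} {s : Set ℝ} {t τ : ℝ}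
    (hs : UniqueDiffWithinAt ℝ s τ) (hc : MDifferentiableWithinAt 𝓘(ℝ, ℝ) 𝓘(ℝ, E) c s τ)
    (h : (t, c τ) ∈ flowDomain X) :
    mfderivWithin 𝓘(ℝ, ℝ) 𝓘(ℝ, E) (transport X c t) s τ =
      mfderiv 𝓘(ℝ, E) 𝓘(ℝ, E) (flow X t) (c τ) ∘L mfderivWithin 𝓘(ℝ, ℝ) 𝓘(ℝ, E) c s τ :=
  mfderiv_comp_mfderivWithin τ ((contMDiffAt_flow_right hX 1 h).mdifferentiableAt (by simp)) hc
    (uniqueMDiffWithinAt_iff_uniqueDiffWithinAt.2 hs)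

variable [RiemannianBundle (fun x : M ↦ TangentSpace 𝓘(ℝ, E) x)]
  [IsContMDiffRiemannianBundle 𝓘(ℝ, E) ∞ E (fun x : M ↦ TangentSpace 𝓘(ℝ, E) x)]

-- A locally bounded function is bounded on compact sets.
omit [T2Space M] in
lemma bddAbove_norm_leviCivita
    (hX : ContMDiff 𝓘(ℝ, E) 𝓘(ℝ, E).tangent ∞
      (fun p : M ↦ (⟨p, X p⟩ : TangentBundle 𝓘(ℝ, E) M))) {K : Set M} (hK : IsCompact K) :
    BddAbove ((fun p ↦ ‖leviCivita X p‖) '' K) := by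
  refine hK.induction_on (p := fun K ↦ BddAbove ((fun p ↦ ‖leviCivita X p‖) '' K)) (by simp)
    (fun s t hst ht ↦ ht.mono (image_mono hst)) (fun s t hs ht ↦ ?_) fun p _ ↦ ?_
  · rw [image_union]
    exact hs.union ht
  · obtain ⟨C, hC⟩ := eventually_norm_leviCivita_le (hX p)
    exact ⟨_, mem_nhdsWithin_of_mem_nhds hC, C, by rintro _ ⟨q, hq, rfl⟩; exact hq⟩

/-- The swept region is the image of a compact product under the continuous flow. -/
lemma bddAbove_sweptNorms
    (hX : ContMDiff 𝓘(ℝ, E) 𝓘(ℝ, E).tangent ∞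
      (fun p : M ↦ (⟨p, X p⟩ : TangentBundle 𝓘(ℝ, E) M))) {c : ℝ → M} {a b T : ℝ}
    (hc : ContinuousOn c (Icc a b)) (h : Icc 0 T ×ˢ (c '' Icc a b) ⊆ flowDomain X) :
    BddAbove (sweptNorms X c a b T) := by
  have hK := isCompact_image_flow hX
    (isCompact_Icc.prod (isCompact_Icc.image_of_continuousOn hc)) h
  refine (bddAbove_norm_leviCivita hX hK).mono ?_
  rintro _ ⟨t, ht, τ, hτ, rfl⟩
  exact ⟨_, ⟨(t, c τ), ⟨ht, mem_image_of_mem c hτ⟩, rfl⟩, rfl⟩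

/-- The chain rule gives the velocity of the transported curve as the differential of the flow on
that of `c`; the Gronwall bound holds for each τ and is integrated. -/
lemma pathELength_transport_le
    (hX : ContMDiff 𝓘(ℝ, E) 𝓘(ℝ, E).tangent ∞
      (fun p : M ↦ (⟨p, X p⟩ : TangentBundle 𝓘(ℝ, E) M))) {c : ℝ → M} {a b T C : ℝ}
    (hab : a < b) (hc : ContMDiffOn 𝓘(ℝ, ℝ) 𝓘(ℝ, E) 1 c (Icc a b))
    (h : Icc 0 T ×ˢ (c '' Icc a b) ⊆ flowDomain X)
    (hC : ∀ r ∈ sweptNorms X c a b T, r ≤ C) {t : ℝ} (ht : t ∈ Icc 0 T) :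
    Manifold.pathELength 𝓘(ℝ, E) (transport X c t) a b ≤
      Manifold.pathELength 𝓘(ℝ, E) c a b * ENNReal.ofReal (Real.exp (C * t)) := by
  rw [Manifold.pathELength_eq_lintegral_mfderivWithin_Icc,
    Manifold.pathELength_eq_lintegral_mfderivWithin_Icc,
    ← lintegral_mul_const' _ _ ENNReal.ofReal_ne_top]
  refine setLIntegral_mono' measurableSet_Icc fun τ hτ ↦ ?_
  have hd (s) (hs : s ∈ Icc 0 T) : (s, c τ) ∈ flowDomain X := h ⟨hs, mem_image_of_mem c hτ⟩
  rw [mfderivWithin_transport hX (uniqueDiffOn_Icc hab τ hτ)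
    ((hc τ hτ).mdifferentiableWithinAt (by simp)) (hd t ht)]
  rw [← ofReal_norm, ← ofReal_norm, ← ENNReal.ofReal_mul (norm_nonneg _)]
  exact ENNReal.ofReal_le_ofReal (norm_mfderiv_flow_le hX _ hd
    (fun s hs ↦ hC _ ⟨s, hs, τ, hτ, rfl⟩) ht)

end Transport

end RiemannianGronwall

theorem proposition1
    {E : Type*} [NormedAddCommGroup E] [NormedSpace ℝ E] [FiniteDimensional ℝ E]
    {M : Type*} [TopologicalSpace M] [T2Space M] [ChartedSpace E M] [IsManifold 𝓘(ℝ, E) ∞ M]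
    [RiemannianBundle (fun x : M ↦ TangentSpace 𝓘(ℝ, E) x)]
    [IsContMDiffRiemannianBundle 𝓘(ℝ, E) ∞ E (fun x : M ↦ TangentSpace 𝓘(ℝ, E) x)]
    (X : ∀ p : M, TangentSpace 𝓘(ℝ, E) p)
    (hX : ContMDiff 𝓘(ℝ, E) 𝓘(ℝ, E).tangent ∞
      (fun p : M ↦ (⟨p, X p⟩ : TangentBundle 𝓘(ℝ, E) M)))
    (a b : ℝ) (hab : a < b) (c₀ : ℝ → M)
    (hc₀ : ContMDiffOn 𝓘(ℝ, ℝ) 𝓘(ℝ, E) ∞ c₀ (Icc a b))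
    (hreg : ∀ τ ∈ Icc a b,
      mfderivWithin 𝓘(ℝ, ℝ) 𝓘(ℝ, E) c₀ (Icc a b) τ (1 : ℝ) ≠ 0)
    (T : ℝ) (hT : 0 < T)
    (hflow : Icc 0 T ×ˢ (c₀ '' Icc a b) ⊆ RiemannianGronwall.flowDomain X) :
    BddAbove (RiemannianGronwall.sweptNorms X c₀ a b T) ∧
    ∀ t ∈ Icc 0 T,
      ContMDiffOn 𝓘(ℝ, ℝ) 𝓘(ℝ, E) 1 (RiemannianGronwall.transport X c₀ t) (Icc a b) ∧
      Manifold.pathELength 𝓘(ℝ, E) (RiemannianGronwall.transport X c₀ t) a b ≠ ⊤ ∧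
      (Manifold.pathELength 𝓘(ℝ, E) (RiemannianGronwall.transport X c₀ t) a b).toReal ≤
        (Manifold.pathELength 𝓘(ℝ, E) c₀ a b).toReal *
          Real.exp (sSup (RiemannianGronwall.sweptNorms X c₀ a b T) * t) := by
  have hc : ContMDiffOn 𝓘(ℝ, ℝ) 𝓘(ℝ, E) 1 c₀ (Icc a b) :=
    hc₀.of_le (by exact_mod_cast le_top)
  have hbdd := RiemannianGronwall.bddAbove_sweptNorms hX hc.continuousOn hflow
  refine ⟨hbdd, fun t ht ↦ ?_⟩
  have hct := RiemannianGronwall.contMDiffOn_transport hX hc (t := t)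
    fun τ hτ ↦ hflow ⟨ht, mem_image_of_mem c₀ hτ⟩
  refine ⟨hct, RiemannianGronwall.pathELength_ne_top hab hct, ?_⟩
  have hle := RiemannianGronwall.pathELength_transport_le hX hab hc hflow
    (fun r hr ↦ le_csSup hbdd hr) ht
  have htop := RiemannianGronwall.pathELength_ne_top hab hc
  -- Finiteness of the right side is essential here, since `toReal` sends `⊤` to `0`.
  refine (ENNReal.toReal_mono (ENNReal.mul_ne_top htop ENNReal.ofReal_ne_top) hle).trans_eq ?_
  rw [ENNReal.toReal_mul, ENNReal.toReal_ofReal (Real.exp_nonneg _)]
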